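/- Let $\nu\in\mathbb{N}$, $\nu\ge 1$, and let $$f(\lambda)=c\,|\lambda|^{-2\alpha}(1+\lambda^2)^{-\beta},\qquad \lambda\in\mathbb{R},\quad c>0,\ \alpha>0,\ \beta>0,$$ be the spectral density of a fractional Riesz–Bessel motion. Let $g$ be an integrable real-valued even function on $\mathbb{R}$. Suppose that for some $1\le p<\infty$ and $1\le q\le\infty$ with $1/p+1/q\le 1/\nu$ (where $1/\infty=0$) we have $g\in L^q(\mathbb{R})$, $0<\alpha<1/(2p)$ and $\alpha+\beta>1/2$. For an integrable real-valued even function $h$ on $\mathbb{R}$ and $T>0$ let $\widehat h(t)=\int_{\mathbb{R}}e^{i\lambda t}h(\lambda)\,d\lambda$, let $W_T(h)$ be the truncated Toeplitz operator on $L^2[0,T]$ given by $[W_T(h)u](t)=\int_0^T\widehat h(t-s)u(s)\,ds$, and put $$\Delta_{\nu,W}(T)=\left|\frac1T\operatorname{tr}\big[W_T(f)W_T(g)\big]^{\nu}-(2\pi)^{2\nu-1}\int_{-\infty}^{\infty}[f(\lambda)g(\lambda)]^{\nu}\,d\lambda\right|.$$ Then $\Delta_{\nu,W}(T)$ is well defined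 ($f$ and $(fg)^\nu$ are integrable, and $[W_T(f)W_T(g)]^\nu$ is a trace class operator for every $T>0$), and $$\Delta_{\nu,W}(T)=o(1)\qquad\text{as } T\to\infty .$$ -/

import Mathlib

open MeasureTheory Filter Topology Set Asymptotics
open scoped ENNReal InnerProductSpace

namespace RieszBessel

/-- The spectral density `c |x|^{-2α} (1 + x^2)^{-β}` of a fractional Riesz-Bessel motion. -/
noncomputable def density (c α β : ℝ) (x : ℝ) : ℝ :=
  c * |x| ^ (-(2 * α)) * (1 + x ^ 2) ^ (-β)

/-- The Fourier transform `ĥ(t) = ∫ e^{ixt} h(x) dx`. -/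
noncomputable def fourierHat (h : ℝ → ℝ) (t : ℝ) : ℂ :=
  ∫ x : ℝ, Complex.exp (Complex.I * (x : ℂ) * (t : ℂ)) * (h x : ℂ)

theorem norm_fourierHat_le (h : ℝ → ℝ) (t : ℝ) : ‖fourierHat h t‖ ≤ ∫ x : ℝ, |h x| := by
  refine (norm_integral_le_integral_norm _).trans (le_of_eq ?_)
  congr 1
  funext x
  have h1 : Complex.I * (x : ℂ) * (t : ℂ) = ((x * t : ℝ) : ℂ) * Complex.I := by
    push_cast; ring
  rw [norm_mul, h1, Complex.norm_exp_ofReal_mul_I, one_mul, Complex.norm_real, Real.norm_eq_abs]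

theorem continuous_fourierHat (h : ℝ → ℝ) : Continuous (fourierHat h) := by
  by_cases hi : Integrable h
  · refine continuous_of_dominated (bound := fun x => |h x|) ?_ ?_ hi.abs ?_
    · intro t
      exact (by fun_prop : Continuous fun x : ℝ =>
        Complex.exp (Complex.I * (x : ℂ) * (t : ℂ))).aestronglyMeasurable.mul
          hi.ofReal.aestronglyMeasurable
    · intro t
      refine Eventually.of_forall fun x => le_of_eq ?_
      have h1 : Complex.I * (x : ℂ) * (t : ℂ) = ((x * t : ℝ) : ℂ) * Complex.I := by
        push_cast; ring
      rw [norm_mul, h1, Complex.norm_exp_ofReal_mul_I, one_mul, Complex.norm_real,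
        Real.norm_eq_abs]
    · exact Eventually.of_forall fun x => by fun_prop
  · have h0 : fourierHat h = fun _ => 0 := by
      funext t
      refine integral_undef fun hc => hi ?_
      have h2 := hc.bdd_mul (c := 1) (f := fun x : ℝ => Complex.exp (-(Complex.I * (x : ℂ) * (t : ℂ))))
        (by fun_prop : Continuous fun x : ℝ =>
          Complex.exp (-(Complex.I * (x : ℂ) * (t : ℂ)))).aestronglyMeasurable
        (Eventually.of_forall fun x => by
          have h1 : -(Complex.I * (x : ℂ) * (t : ℂ)) = ((-(x * t) : ℝ) : ℂ) * Complex.I := by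
            push_cast; ring
          rw [h1, Complex.norm_exp_ofReal_mul_I])
      have h3 : Integrable fun x => ((h x : ℝ) : ℂ) := by
        refine h2.congr (Eventually.of_forall fun x => ?_)
        simp only
        rw [← mul_assoc, ← Complex.exp_add, neg_add_cancel, Complex.exp_zero, one_mul]
      simpa using h3.re
    rw [h0]
    exact continuous_const

/-- The complex Hilbert space `L²[0,T]`. -/
abbrev L2 (T : ℝ) : Type := Lp ℂ 2 (volume.restrict (Icc (0 : ℝ) T))

/-- The function `t ↦ ∫_0^T ĥ(t - s) u(s) ds`. -/
noncomputable def toeplitzFun (T : ℝ) (h : ℝ → ℝ) (u : ℝ → ℂ) (t : ℝ) : ℂ :=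
  ∫ s in Icc (0 : ℝ) T, fourierHat h (t - s) * u s

theorem integrable_L2 {T : ℝ} (u : L2 T) :
    Integrable u (volume.restrict (Icc (0 : ℝ) T)) :=
  (Lp.memLp u).integrable (by norm_num)

theorem integrable_toeplitz {T : ℝ} (h : ℝ → ℝ) (u : L2 T) (t : ℝ) :
    Integrable (fun s => fourierHat h (t - s) * u s) (volume.restrict (Icc (0 : ℝ) T)) :=
  (integrable_L2 u).bdd_mul (c := ∫ x : ℝ, |h x|)
    ((continuous_fourierHat h).comp (continuous_const.sub continuous_id)).aestronglyMeasurable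
    (Eventually.of_forall fun s => norm_fourierHat_le h (t - s))

theorem norm_toeplitzFun_le {T : ℝ} (h : ℝ → ℝ) (u : L2 T) (t : ℝ) :
    ‖toeplitzFun T h u t‖ ≤ (∫ x : ℝ, |h x|) * ∫ s in Icc (0 : ℝ) T, ‖u s‖ := by
  refine (norm_integral_le_integral_norm _).trans ?_
  rw [← integral_const_mul]
  refine integral_mono (integrable_toeplitz h u t).norm ((integrable_L2 u).norm.const_mul _) ?_
  intro s
  simp only [norm_mul]
  exact mul_le_mul_of_nonneg_right (norm_fourierHat_le h _) (norm_nonneg _)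

theorem integral_norm_L2_le {T : ℝ} (u : L2 T) :
    ∫ s in Icc (0 : ℝ) T, ‖u s‖ ≤
      ((volume.restrict (Icc (0 : ℝ) T)) univ ^ (1 / 2 : ℝ)).toReal * ‖u‖ := by
  have h1 := eLpNorm_le_eLpNorm_mul_rpow_measure_univ (μ := volume.restrict (Icc (0 : ℝ) T))
    (p := 1) (q := 2) (by norm_num) (Lp.aestronglyMeasurable u)
  rw [integral_norm_eq_lintegral_enorm (Lp.aestronglyMeasurable u), Lp.norm_def,
    ← eLpNorm_one_eq_lintegral_enorm, mul_comm, ← ENNReal.toReal_mul]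
  refine ENNReal.toReal_mono ?_ ?_
  · exact ENNReal.mul_ne_top (Lp.eLpNorm_ne_top u)
      (ENNReal.rpow_ne_top_of_nonneg (by norm_num) (measure_ne_top _ _))
  · convert h1 using 3
    norm_num

theorem memLp_toeplitzFun {T : ℝ} (h : ℝ → ℝ) (u : L2 T) :
    MemLp (toeplitzFun T h u) 2 (volume.restrict (Icc (0 : ℝ) T)) := by
  refine MemLp.of_bound ?_ _ (Eventually.of_forall (norm_toeplitzFun_le h u))
  have h1 : StronglyMeasurable fun z : ℝ × ℝ => fourierHat h (z.1 - z.2) * u z.2 :=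
    ((continuous_fourierHat h).comp (continuous_fst.sub continuous_snd)).stronglyMeasurable.mul
      ((Lp.stronglyMeasurable u).comp_measurable measurable_snd)
  exact h1.integral_prod_right.aestronglyMeasurable

/-- The `T`-truncated Toeplitz operator `W_T(h)` on `L²[0,T]`,
`[W_T(h) u](t) = ∫_0^T ĥ(t - s) u(s) ds`. -/
noncomputable def toeplitzOp (T : ℝ) (h : ℝ → ℝ) : L2 T →L[ℂ] L2 T :=
  LinearMap.mkContinuous
    { toFun := fun u => (memLp_toeplitzFun h u).toLp
      map_add' := fun u v => by
        rw [← MemLp.toLp_add]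
        refine MemLp.toLp_congr _ _ (Eventually.of_forall fun t => ?_)
        simp only [toeplitzFun, Pi.add_apply]
        rw [← integral_add (integrable_toeplitz h u t) (integrable_toeplitz h v t)]
        refine integral_congr_ae ?_
        filter_upwards [Lp.coeFn_add u v] with s hs
        rw [hs, Pi.add_apply, mul_add]
      map_smul' := fun a u => by
        rw [RingHom.id_apply, ← MemLp.toLp_const_smul]
        refine MemLp.toLp_congr _ _ (Eventually.of_forall fun t => ?_)
        simp only [toeplitzFun, Pi.smul_apply, smul_eq_mul]
        rw [← integral_const_mul]
        refine integral_congr_ae ?_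
        filter_upwards [Lp.coeFn_smul a u] with s hs
        rw [hs, Pi.smul_apply, smul_eq_mul]
        ring }
    (((volume.restrict (Icc (0 : ℝ) T)) univ ^ (1 / 2 : ℝ)).toReal * ((∫ x : ℝ, |h x|) *
      ((volume.restrict (Icc (0 : ℝ) T)) univ ^ (1 / 2 : ℝ)).toReal)) (fun u => by
      have hC : 0 ≤ ∫ x : ℝ, |h x| := integral_nonneg fun x => abs_nonneg _
      have h1 : ∀ᵐ t ∂(volume.restrict (Icc (0 : ℝ) T)),
          ‖((memLp_toeplitzFun h u).toLp (toeplitzFun T h u) : L2 T) t‖ ≤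
            (∫ x : ℝ, |h x|) * ∫ s in Icc (0 : ℝ) T, ‖u s‖ := by
        filter_upwards [(memLp_toeplitzFun h u).coeFn_toLp] with t ht
        rw [ht]
        exact norm_toeplitzFun_le h u t
      have h2 := Lp.norm_le_of_ae_bound (mul_nonneg hC (integral_nonneg fun s => norm_nonneg _)) h1
      refine h2.trans ?_
      rw [mul_assoc, mul_assoc]
      have h3 : (measureUnivNNReal (volume.restrict (Icc (0 : ℝ) T)) : ℝ) ^ (ENNReal.toReal 2)⁻¹
          = ((volume.restrict (Icc (0 : ℝ) T)) univ ^ (1 / 2 : ℝ)).toReal := by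
        rw [← ENNReal.toReal_rpow, ENNReal.toReal_ofNat, one_div]
        rfl
      rw [h3]
      exact mul_le_mul_of_nonneg_left
        (mul_le_mul_of_nonneg_left (integral_norm_L2_le u) hC) ENNReal.toReal_nonneg)

theorem toeplitzOp_apply (T : ℝ) (h : ℝ → ℝ) (u : L2 T) :
    toeplitzOp T h u =ᵐ[volume.restrict (Icc (0 : ℝ) T)]
      fun t => ∫ s in Icc (0 : ℝ) T, fourierHat h (t - s) * u s :=
  (memLp_toeplitzFun h u).coeFn_toLp

section Trace

universe w

/-- The bounded operator `A` on a complex Hilbert space is of trace class with trace `τ`: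
for every orthonormal basis `(b i)` the sum `∑ i, ⟪b i, A (b i)⟫` converges unconditionally
(equivalently, absolutely), with the same value `τ`. -/
def HasTrace {H : Type w} [NormedAddCommGroup H] [InnerProductSpace ℂ H] [CompleteSpace H]
    (A : H →L[ℂ] H) (τ : ℂ) : Prop :=
  ∀ (ι : Type w) (b : HilbertBasis ι ℂ H), HasSum (fun i => ⟪b i, A (b i)⟫_ℂ) τ

/-- `A` is a trace class operator. -/
def IsTraceClass {H : Type w} [NormedAddCommGroup H] [InnerProductSpace ℂ H] [CompleteSpace H]
    (A : H →L[ℂ] H) : Prop :=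
  ∃ τ : ℂ, HasTrace A τ

open Classical in
/-- The trace of a trace class operator (and `0` for other operators). -/
noncomputable def trace {H : Type w} [NormedAddCommGroup H] [InnerProductSpace ℂ H]
    [CompleteSpace H] (A : H →L[ℂ] H) : ℂ :=
  if hA : IsTraceClass A then hA.choose else 0

theorem HasTrace.trace_eq {H : Type w} [NormedAddCommGroup H] [InnerProductSpace ℂ H]
    [CompleteSpace H] {A : H →L[ℂ] H} {τ : ℂ} (hA : HasTrace A τ) : trace A = τ := by
  have h1 : IsTraceClass A := ⟨τ, hA⟩
  obtain ⟨s, b, -⟩ := exists_hilbertBasis ℂ H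
  rw [trace, dif_pos h1]
  exact (h1.choose_spec s b).unique (hA s b)

end Trace

/-- The operator `[W_T(f) W_T(g)]^ν` on `L²[0,T]`. -/
noncomputable def toeplitzProd (ν : ℕ) (f g : ℝ → ℝ) (T : ℝ) : L2 T →L[ℂ] L2 T :=
  (toeplitzOp T f * toeplitzOp T g) ^ ν

/-- `S_{ν,W}(T) = (1/T) tr [W_T(f) W_T(g)]^ν`. -/
noncomputable def normalizedTrace (ν : ℕ) (f g : ℝ → ℝ) (T : ℝ) : ℂ :=
  (1 / (T : ℂ)) * trace (toeplitzProd ν f g T)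

/-- `Δ_{ν,W}(T) = |S_{ν,W}(T) - (2π)^{2ν-1} ∫ [f(x) g(x)]^ν dx|`. -/
noncomputable def traceError (ν : ℕ) (f g : ℝ → ℝ) (T : ℝ) : ℝ :=
  ‖normalizedTrace ν f g T -
    (((2 * Real.pi) ^ (2 * ν - 1) * ∫ x : ℝ, (f x * g x) ^ ν : ℝ) : ℂ)‖

end RieszBessel

/-! With e_y(t) = e^{iyt} on [0,T], the operator W_T(h) is the superposition ∫ h(y) ⟪e_y, ·⟫ e_y dy
(`inner_toeplitzOp`). Hence the trace of W_T(h₀)⋯W_T(h_m) is the integral of ∏ h_i(x_i) against the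
cyclic product of Dirichlet kernels D_T(x_{i+1} - x_i). Substituting x₀ = x, x_i = x + y_i/T turns
it into T ∫ K(y) J(y/T) dy (`hasTrace_toeplitzChain`), where K is the cyclic product of kernels D_1
through 0, y₁, …, y_m, 0 and J(z) = ∫ h₀(x) ∏ h_i(x + z_i) dx.

Three facts give the limit. K is integrable on ℝ^m (`exists_lintegral_chainKernel_le`). Its integral
is (2π)^m, because D_1 reproduces itself under convolution up to the factor 2π
(`integral_chainKernel`). If h_i ∈ L^{p_i} with finite p_i and ∑ 1/p_i = 1, then J is bounded by
Hölder's inequality and continuous at 0 because translation is continuous in L^{p_i}. Dominated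
convergence then yields (2π)^m J(0) (`tendsto_trace_toeplitzChain`).

For the theorem, m + 1 = 2ν and the symbols alternate between f and g. Since α < 1/(2p) is strict, f
lies in L^s for some s > p; this slack leaves room for a finite r ≤ q with 1/s + 1/r = 1/ν, even
when q = ∞ (`exists_conjugate_exponents`), and g ∈ L¹ ∩ L^q lies in L^r. -/

/-! ### Plancherel's theorem on L¹ ∩ L² -/

open scoped FourierTransform SchwartzMap in
/-- The `L²` Fourier transform agrees with the Fourier integral on `L¹ ∩ L²`. -/
theorem MeasureTheory.MemLp.toLp_fourier_eq {φ : ℝ → ℂ} (h1 : Integrable φ) (h2 : MemLp φ 2)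
    (h3 : MemLp (𝓕 φ) 2) : 𝓕 (h2.toLp φ) = h3.toLp (𝓕 φ) := by
  -- An L² function is determined by its tempered distribution, so it suffices to test against
  -- Schwartz ψ, where the claim is the duality ∫ 𝓕ψ · φ = ∫ ψ · 𝓕φ.
  have hinj := LinearMap.ker_eq_bot.1
    (Lp.ker_toTemperedDistributionCLM_eq_bot (F := ℂ) (μ := (volume : Measure ℝ)) (p := 2))
  apply hinj
  change ((𝓕 (h2.toLp φ) : Lp ℂ 2 (volume : Measure ℝ)) : 𝓢'(ℝ, ℂ))
    = ((h3.toLp (𝓕 φ) : Lp ℂ 2 (volume : Measure ℝ)) : 𝓢'(ℝ, ℂ))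
  rw [← Lp.fourier_toTemperedDistribution_eq]
  ext ψ
  rw [TemperedDistribution.fourier_apply, Lp.toTemperedDistribution_apply,
    Lp.toTemperedDistribution_apply]
  have e1 : ∫ x, (𝓕 ψ) x • (h2.toLp φ) x = ∫ x, (𝓕 (ψ : ℝ → ℂ)) x • φ x := by
    refine integral_congr_ae ?_
    filter_upwards [h2.coeFn_toLp] with x hx
    rw [hx, SchwartzMap.fourier_coe]
  have e2 : ∫ x, ψ x • (h3.toLp (𝓕 φ)) x = ∫ x, ψ x • (𝓕 φ) x := by
    refine integral_congr_ae ?_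
    filter_upwards [h3.coeFn_toLp] with x hx
    rw [hx]
  rw [e1, e2]
  have := VectorFourier.integral_fourierIntegral_smul_eq_flip (L := innerₗ ℝ)
      Real.continuous_fourierChar continuous_inner (μ := volume) (ν := volume)
      ψ.integrable h1
  simpa using! this

open scoped FourierTransform in
/-- Plancherel's theorem for the Fourier integral on `L¹ ∩ L²`. -/
theorem MeasureTheory.integral_conj_fourier_mul_fourier {φ ψ : ℝ → ℂ}
    (h1 : Integrable φ) (h2 : MemLp φ 2) (h3 : MemLp (𝓕 φ) 2)
    (k1 : Integrable ψ) (k2 : MemLp ψ 2) (k3 : MemLp (𝓕 ψ) 2) :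
    ∫ w, (starRingEnd ℂ) (𝓕 φ w) * 𝓕 ψ w = ∫ t, (starRingEnd ℂ) (φ t) * ψ t := by
  have h := Lp.inner_fourier_eq (h2.toLp φ) (k2.toLp ψ)
  rw [MemLp.toLp_fourier_eq h1 h2 h3, MemLp.toLp_fourier_eq k1 k2 k3, L2.inner_def, L2.inner_def]
    at h
  have e1 : ∫ w, (starRingEnd ℂ) (𝓕 φ w) * 𝓕 ψ w
      = ∫ w, ⟪(h3.toLp (𝓕 φ)) w, (k3.toLp (𝓕 ψ)) w⟫_ℂ := by
    refine integral_congr_ae ?_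
    filter_upwards [h3.coeFn_toLp, k3.coeFn_toLp] with x hx hy
    rw [hx, hy, RCLike.inner_apply, mul_comm]
  have e2 : ∫ w, (starRingEnd ℂ) (φ w) * ψ w
      = ∫ w, ⟪(h2.toLp φ) w, (k2.toLp ψ) w⟫_ℂ := by
    refine integral_congr_ae ?_
    filter_upwards [h2.coeFn_toLp, k2.coeFn_toLp] with x hx hy
    rw [hx, hy, RCLike.inner_apply, mul_comm]
  rw [e1, e2, h]

/-! ### The Dirichlet kernel -/

namespace RieszBessel

theorem norm_exp_I_mul_mul (x t : ℝ) : ‖Complex.exp (Complex.I * (x : ℂ) * (t : ℂ))‖ = 1 := by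
  have h1 : Complex.I * (x : ℂ) * (t : ℂ) = ((x * t : ℝ) : ℂ) * Complex.I := by
    push_cast; ring
  rw [h1, Complex.norm_exp_ofReal_mul_I]

theorem conj_exp_I_mul_mul (x t : ℝ) :
    (starRingEnd ℂ) (Complex.exp (Complex.I * (x : ℂ) * (t : ℂ)))
      = Complex.exp (Complex.I * ((-x : ℝ) : ℂ) * (t : ℂ)) := by
  rw [← Complex.exp_conj]
  congr 1
  simp

/-- The Dirichlet kernel `∫_0^T e^{ist} dt`. -/
noncomputable def dirichlet (T s : ℝ) : ℂ :=
  ∫ t in Icc (0 : ℝ) T, Complex.exp (Complex.I * (s : ℂ) * (t : ℂ))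

theorem norm_dirichlet_le {T : ℝ} (hT : 0 ≤ T) (s : ℝ) : ‖dirichlet T s‖ ≤ T := by
  have h := norm_setIntegral_le_of_norm_le_const (μ := volume) (s := Icc (0 : ℝ) T) (C := 1)
    (f := fun t : ℝ => Complex.exp (Complex.I * (s : ℂ) * (t : ℂ)))
    (by simp) (fun t _ => (norm_exp_I_mul_mul s t).le)
  simpa [dirichlet, hT] using h

theorem continuous_dirichlet (T : ℝ) : Continuous (dirichlet T) := by
  refine continuous_of_dominated (bound := fun _ => 1) ?_ ?_ ?_ ?_
  · intro s
    exact (by fun_prop : Continuous fun t : ℝ =>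
      Complex.exp (Complex.I * (s : ℂ) * (t : ℂ))).aestronglyMeasurable
  · exact fun s => Eventually.of_forall fun t => (norm_exp_I_mul_mul s t).le
  · exact integrable_const _
  · exact Eventually.of_forall fun t => by fun_prop

theorem dirichlet_eq_mul {T : ℝ} (hT : 0 < T) (s : ℝ) :
    dirichlet T s = T * dirichlet 1 (T * s) := by
  simp only [dirichlet]
  rw [integral_Icc_eq_integral_Ioc, integral_Icc_eq_integral_Ioc,
    ← intervalIntegral.integral_of_le hT.le, ← intervalIntegral.integral_of_le zero_le_one]
  have h := intervalIntegral.smul_integral_comp_mul_left (a := 0) (b := 1)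
    (fun t : ℝ => Complex.exp (Complex.I * (s : ℂ) * (t : ℂ))) T
  rw [mul_zero, mul_one] at h
  rw [← h, Complex.real_smul]
  congr 2
  funext t
  push_cast
  ring_nf

theorem conj_dirichlet (T s : ℝ) : (starRingEnd ℂ) (dirichlet T s) = dirichlet T (-s) := by
  rw [dirichlet, dirichlet, ← integral_conj]
  simp only [conj_exp_I_mul_mul]

/-- The constant is 3 = 1 + 2: the trivial bound ‖D_1(s)‖ ≤ 1 plus ‖D_1(s)‖ |s| ≤ 2 from the
explicit antiderivative. -/
theorem norm_dirichlet_one_le (s : ℝ) : ‖dirichlet 1 s‖ ≤ 3 * (1 + |s|) ^ (-1 : ℝ) := by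
  have h1 := norm_dirichlet_le zero_le_one s
  have h0 : 0 < 1 + |s| := by positivity
  rw [Real.rpow_neg_one, ← div_eq_mul_inv, le_div_iff₀ h0]
  have h2 : ‖dirichlet 1 s‖ * |s| ≤ 2 := by
    rcases eq_or_ne s 0 with rfl | hs
    · simp
    · have hc : Complex.I * (s : ℂ) ≠ 0 := mul_ne_zero Complex.I_ne_zero (by exact_mod_cast hs)
      rw [dirichlet, integral_Icc_eq_integral_Ioc, ← intervalIntegral.integral_of_le zero_le_one,
        integral_exp_mul_complex hc, norm_div, norm_mul, Complex.norm_I, one_mul,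
        Complex.norm_real, Real.norm_eq_abs, div_mul_cancel₀ _ (abs_ne_zero.2 hs)]
      refine (norm_sub_le _ _).trans ?_
      rw [norm_exp_I_mul_mul, norm_exp_I_mul_mul]
      norm_num
  nlinarith

theorem one_add_abs_add_le (a b y : ℝ) : 1 + |a - b| ≤ (1 + |y - a|) * (1 + |y - b|) := by
  have h := abs_sub_le a y b
  rw [abs_sub_comm a y] at h
  nlinarith [mul_nonneg (abs_nonneg (y - a)) (abs_nonneg (y - b))]

theorem memLp_two_dirichlet_one : MemLp (dirichlet 1) 2 := by
  rw [memLp_two_iff_integrable_sq_norm (continuous_dirichlet 1).aestronglyMeasurable]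
  have h := (integrable_one_add_norm (E := ℝ) (μ := volume) (r := 2) (by simp)).const_mul 9
  refine h.mono' ((continuous_dirichlet 1).norm.pow 2).aestronglyMeasurable
    (Eventually.of_forall fun s => ?_)
  have h1 := norm_dirichlet_one_le s
  have h0 : 0 < 1 + |s| := by positivity
  rw [Real.norm_of_nonneg (by positivity), Real.norm_eq_abs]
  have h2 : (1 + |s|) ^ (-2 : ℝ) = ((1 + |s|) ^ (-1 : ℝ)) ^ 2 := by
    rw [← Real.rpow_natCast, ← Real.rpow_mul h0.le]; norm_num
  rw [h2]
  calc ‖dirichlet 1 s‖ ^ 2 ≤ (3 * (1 + |s|) ^ (-1 : ℝ)) ^ 2 := by gcongr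
    _ = _ := by ring

open scoped FourierTransform in
theorem fourier_indicator_exp (a w : ℝ) :
    𝓕 ((Icc (0 : ℝ) 1).indicator fun t => Complex.exp (Complex.I * (a : ℂ) * (t : ℂ))) w
      = dirichlet 1 (a - 2 * Real.pi * w) := by
  rw [Real.fourier_real_eq_integral_exp_smul, dirichlet, ← integral_indicator measurableSet_Icc]
  congr 1
  funext t
  by_cases ht : t ∈ Icc (0 : ℝ) 1
  · rw [indicator_of_mem ht, indicator_of_mem ht, smul_eq_mul, ← Complex.exp_add]
    congr 1
    push_cast
    ring
  · rw [indicator_of_notMem ht, indicator_of_notMem ht, smul_zero]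

open scoped FourierTransform in
/-- The reproducing property of the Dirichlet kernel. -/
theorem integral_dirichlet_mul_dirichlet (a b : ℝ) :
    ∫ y, dirichlet 1 (y - a) * dirichlet 1 (b - y) = 2 * Real.pi * dirichlet 1 (b - a) := by
  set φ : ℝ → ℝ → ℂ := fun a =>
    (Icc (0 : ℝ) 1).indicator fun t => Complex.exp (Complex.I * (a : ℂ) * (t : ℂ)) with hφ
  have hbd : ∀ a : ℝ, MemLp (fun t : ℝ => Complex.exp (Complex.I * (a : ℂ) * (t : ℂ))) ⊤
      (volume.restrict (Icc (0 : ℝ) 1)) := fun a =>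
    memLp_top_of_bound (by fun_prop : Continuous fun t : ℝ =>
      Complex.exp (Complex.I * (a : ℂ) * (t : ℂ))).aestronglyMeasurable 1
        (Eventually.of_forall fun t => (norm_exp_I_mul_mul a t).le)
  have h1 : ∀ a, Integrable (φ a) := fun a =>
    (integrable_indicator_iff measurableSet_Icc).2 ((hbd a).integrable le_top)
  have h2 : ∀ a, MemLp (φ a) 2 := fun a =>
    (memLp_indicator_iff_restrict measurableSet_Icc).2 ((hbd a).mono_exponent le_top)
  have hF : ∀ a, 𝓕 (φ a) = fun w => dirichlet 1 (a - 2 * Real.pi * w) := fun a =>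
    funext fun w => fourier_indicator_exp a w
  have h3 : ∀ a, MemLp (𝓕 (φ a)) 2 := by
    intro a
    have hc : Continuous fun w : ℝ => dirichlet 1 (a - 2 * Real.pi * w) :=
      (continuous_dirichlet 1).comp (by fun_prop)
    rw [hF, memLp_two_iff_integrable_sq_norm hc.aestronglyMeasurable]
    have h := (memLp_two_iff_integrable_sq_norm
      (continuous_dirichlet 1).aestronglyMeasurable).1 memLp_two_dirichlet_one
    exact (h.comp_sub_left a).comp_mul_left' (by positivity)
  -- Both kernels are Fourier transforms of exponentials cut off to [0,1], so their correlation is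
  -- an inner product on [0,1]. The factor 2π comes from the substitution y = 2πw.
  have h := integral_conj_fourier_mul_fourier (h1 a) (h2 a) (h3 a) (h1 b) (h2 b) (h3 b)
  simp only [hF, conj_dirichlet] at h
  have e1 : ∫ w : ℝ, dirichlet 1 (-(a - 2 * Real.pi * w)) * dirichlet 1 (b - 2 * Real.pi * w)
      = (2 * Real.pi : ℂ)⁻¹ * ∫ y, dirichlet 1 (y - a) * dirichlet 1 (b - y) := by
    have := Measure.integral_comp_mul_left (fun y => dirichlet 1 (y - a) * dirichlet 1 (b - y))
      (2 * Real.pi)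
    simp only [neg_sub]
    rw [this, abs_of_pos (by positivity), Complex.real_smul]
    push_cast
    rfl
  have e2 : ∫ t, (starRingEnd ℂ) (φ a t) * φ b t = dirichlet 1 (b - a) := by
    rw [dirichlet, ← integral_indicator measurableSet_Icc]
    congr 1
    funext t
    by_cases ht : t ∈ Icc (0 : ℝ) 1
    · simp only [hφ, indicator_of_mem ht]
      rw [conj_exp_I_mul_mul, ← Complex.exp_add]
      congr 1
      push_cast
      ring
    · simp only [hφ, indicator_of_notMem ht, mul_zero]
  rw [e1, e2] at h
  rw [← h, mul_inv_cancel_left₀]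
  exact_mod_cast (by positivity : (2 * Real.pi) ≠ 0)

end RieszBessel

/-! ### Splitting off the first coordinate -/

section FinCons

theorem MeasureTheory.measurePreserving_finCons (m : ℕ) :
    MeasurePreserving (fun z : ℝ × (Fin m → ℝ) => (Fin.cons z.1 z.2 : Fin (m + 1) → ℝ)) := by
  have h := (volume_preserving_piFinSuccAbove (fun _ : Fin (m + 1) => ℝ) 0).symm
  convert h using 1
  funext z
  simp [MeasurableEquiv.piFinSuccAbove_symm_apply, Fin.insertNthEquiv]

theorem MeasureTheory.measurableEmbedding_finCons (m : ℕ) :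
    MeasurableEmbedding (fun z : ℝ × (Fin m → ℝ) => (Fin.cons z.1 z.2 : Fin (m + 1) → ℝ)) := by
  have h := (MeasurableEquiv.piFinSuccAbove (fun _ : Fin (m + 1) => ℝ) 0).symm.measurableEmbedding
  convert h using 1
  funext z
  simp [MeasurableEquiv.piFinSuccAbove_symm_apply, Fin.insertNthEquiv]

theorem MeasureTheory.integrable_finCons_iff {m : ℕ} {F : (Fin (m + 1) → ℝ) → ℂ} :
    Integrable (fun z : ℝ × (Fin m → ℝ) => F (Fin.cons z.1 z.2)) ↔ Integrable F :=
  (measurePreserving_finCons m).integrable_comp_emb (measurableEmbedding_finCons m)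

theorem MeasureTheory.integral_fin_succ {m : ℕ} {F : (Fin (m + 1) → ℝ) → ℂ} (hF : Integrable F) :
    ∫ x, F x = ∫ y : ℝ, ∫ x : Fin m → ℝ, F (Fin.cons y x) := by
  rw [← (measurePreserving_finCons m).integral_comp (measurableEmbedding_finCons m)]
  exact integral_prod _ (integrable_finCons_iff.2 hF)

theorem MeasureTheory.lintegral_fin_succ {m : ℕ} {F : (Fin (m + 1) → ℝ) → ℝ≥0∞}
    (hF : Measurable F) :
    ∫⁻ x, F x = ∫⁻ y : ℝ, ∫⁻ x : Fin m → ℝ, F (Fin.cons y x) := by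
  rw [← (measurePreserving_finCons m).lintegral_comp hF]
  exact lintegral_prod _ (hF.comp (measurePreserving_finCons m).measurable).aemeasurable

end FinCons

/-! ### Chains of Dirichlet kernels -/

namespace RieszBessel

/-- The product `D_T(x₀ - a) D_T(x₁ - x₀) ⋯ D_T(b - x_{m-1})` of Dirichlet kernels along the
chain `a, x₀, …, x_{m-1}, b`. -/
noncomputable def chainKernel (T : ℝ) : (m : ℕ) → ℝ → (Fin m → ℝ) → ℝ → ℂ
  | 0, a, _, b => dirichlet T (b - a)
  | m + 1, a, x, b => dirichlet T (x 0 - a) * chainKernel T m (x 0) (Fin.tail x) b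

theorem chainKernel_cons (T : ℝ) (m : ℕ) (a y : ℝ) (x : Fin m → ℝ) (b : ℝ) :
    chainKernel T (m + 1) a (Fin.cons y x) b = dirichlet T (y - a) * chainKernel T m y x b := by
  simp [chainKernel]

theorem continuous_chainKernel (T : ℝ) (m : ℕ) :
    Continuous fun z : ℝ × (Fin m → ℝ) × ℝ => chainKernel T m z.1 z.2.1 z.2.2 := by
  induction m with
  | zero => exact (continuous_dirichlet T).comp (by fun_prop)
  | succ m ih =>
    simp only [chainKernel]
    refine ((continuous_dirichlet T).comp (by fun_prop)).mul ?_
    exact ih.comp (f := fun z : ℝ × (Fin (m + 1) → ℝ) × ℝ => (z.2.1 0, Fin.tail z.2.1, z.2.2))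
      (by unfold Fin.tail; fun_prop)

theorem norm_chainKernel_le {T : ℝ} (hT : 0 ≤ T) (m : ℕ) (a : ℝ) (x : Fin m → ℝ) (b : ℝ) :
    ‖chainKernel T m a x b‖ ≤ T ^ (m + 1) := by
  induction m generalizing a with
  | zero => simpa [chainKernel] using norm_dirichlet_le hT (b - a)
  | succ m ih =>
    rw [chainKernel, norm_mul, pow_succ' T]
    exact mul_le_mul (norm_dirichlet_le hT _) (ih _ _) (norm_nonneg _) hT

/-- Only the m + 1 successive differences matter, and each contributes a factor T through D_T(s) = T
D_1(Ts). -/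
theorem chainKernel_add_div {T : ℝ} (hT : 0 < T) (m : ℕ) (l a : ℝ) (x : Fin m → ℝ) (b : ℝ) :
    chainKernel T m (l + a / T) (fun i => l + x i / T) (l + b / T)
      = T ^ (m + 1) * chainKernel 1 m a x b := by
  have hd : ∀ u v : ℝ, dirichlet T (l + u / T - (l + v / T)) = T * dirichlet 1 (u - v) := by
    intro u v
    rw [dirichlet_eq_mul hT]
    congr 2
    field_simp
    ring
  induction m generalizing a with
  | zero => simp only [chainKernel, hd, zero_add, pow_one]
  | succ m ih =>
    rw [chainKernel, chainKernel, hd]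
    have := ih (x 0) (Fin.tail x)
    rw [show (Fin.tail fun i => l + x i / T) = fun i => l + Fin.tail x i / T from rfl, this]
    ring

/-- A power (uv)^{-θ/3} is spent on decay in s. The remaining exponents are both nonpositive and add
up to -(1 + θ/3), so replacing the larger base by the smaller gives an integrable weight in a single
variable. -/
theorem rpow_mul_rpow_le {θ u v s : ℝ} (hθ : 0 < θ) (hθ1 : θ ≤ 1) (hu : 1 ≤ u) (hv : 1 ≤ v)
    (hs : 1 ≤ s) (hsuv : s ≤ u * v) :
    u ^ (-1 : ℝ) * v ^ (-θ) ≤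
      s ^ (-(θ / 3)) * (u ^ (-(1 + θ / 3)) + v ^ (-(1 + θ / 3))) := by
  have hu0 : 0 < u := by linarith
  have hv0 : 0 < v := by linarith
  have hs0 : 0 < s := by linarith
  have h1 : (u * v) ^ (-(θ / 3)) ≤ s ^ (-(θ / 3)) :=
    Real.rpow_le_rpow_of_nonpos hs0 hsuv (by linarith)
  have h2 : u ^ (-1 : ℝ) * v ^ (-θ)
      = (u * v) ^ (-(θ / 3)) * (u ^ (θ / 3 - 1) * v ^ (-(2 * θ / 3))) := by
    rw [Real.mul_rpow hu0.le hv0.le]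
    rw [show (-1 : ℝ) = -(θ / 3) + (θ / 3 - 1) by ring, Real.rpow_add hu0,
      show (-θ : ℝ) = -(θ / 3) + -(2 * θ / 3) by ring, Real.rpow_add hv0]
    ring_nf
  have h3 : u ^ (θ / 3 - 1) * v ^ (-(2 * θ / 3)) ≤ u ^ (-(1 + θ / 3)) + v ^ (-(1 + θ / 3)) := by
    rcases le_total u v with huv | huv
    · have : v ^ (-(2 * θ / 3)) ≤ u ^ (-(2 * θ / 3)) :=
        Real.rpow_le_rpow_of_nonpos hu0 huv (by linarith)
      calc u ^ (θ / 3 - 1) * v ^ (-(2 * θ / 3)) ≤ u ^ (θ / 3 - 1) * u ^ (-(2 * θ / 3)) := by gcongr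
        _ = u ^ (-(1 + θ / 3)) := by rw [← Real.rpow_add hu0]; ring_nf
        _ ≤ _ := le_add_of_nonneg_right (by positivity)
    · have : u ^ (θ / 3 - 1) ≤ v ^ (θ / 3 - 1) :=
        Real.rpow_le_rpow_of_nonpos hv0 huv (by linarith)
      calc u ^ (θ / 3 - 1) * v ^ (-(2 * θ / 3)) ≤ v ^ (θ / 3 - 1) * v ^ (-(2 * θ / 3)) := by gcongr
        _ = v ^ (-(1 + θ / 3)) := by rw [← Real.rpow_add hv0]; ring_nf
        _ ≤ _ := le_add_of_nonneg_left (by positivity)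
  rw [h2]
  gcongr

/-- D_1 itself is not integrable by the bound 1/(1 + |s|), so the induction carries decay in the
distance between the endpoints. Each integration costs two thirds of the exponent θ, which stays
positive; that suffices for the next step. -/
theorem exists_lintegral_chainKernel_le (m : ℕ) : ∃ C θ : ℝ, 0 ≤ C ∧ 0 < θ ∧ θ ≤ 1 ∧ ∀ a b : ℝ,
    ∫⁻ x, ‖chainKernel 1 m a x b‖ₑ ≤ ENNReal.ofReal (C * (1 + |a - b|) ^ (-θ)) := by
  induction m with
  | zero =>
    refine ⟨3, 1, by norm_num, one_pos, le_rfl, fun a b => ?_⟩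
    have h := norm_dirichlet_one_le (b - a)
    rw [abs_sub_comm b a] at h
    rw [volume_pi, Measure.pi_of_empty (x := 0), lintegral_dirac, chainKernel, ← ofReal_norm]
    exact ENNReal.ofReal_le_ofReal h
  | succ m ih =>
    obtain ⟨C, θ, hC, hθ, hθ1, hle⟩ := ih
    set w : ℝ → ℝ := fun y => (1 + ‖y‖) ^ (-(1 + θ / 3)) with hw
    have hwi : Integrable w := integrable_one_add_norm (by simp; linarith)
    refine ⟨3 * C * (2 * ∫ y, w y), θ / 3, ?_, by linarith, by linarith, fun a b => ?_⟩
    · have : 0 ≤ ∫ y, w y := integral_nonneg fun y => by positivity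
      positivity
    have hmeas : Measurable fun x : Fin (m + 1) → ℝ => ‖chainKernel 1 (m + 1) a x b‖ₑ :=
      ((continuous_chainKernel 1 (m + 1)).comp
        (f := fun x : Fin (m + 1) → ℝ => (a, x, b)) (by fun_prop)).measurable.enorm
    rw [lintegral_fin_succ hmeas]
    have hwab : Integrable fun y => 3 * C * (1 + |a - b|) ^ (-(θ / 3)) * (w (y - a) + w (y - b)) :=
      ((hwi.comp_sub_right a).add (hwi.comp_sub_right b)).const_mul _
    calc ∫⁻ y : ℝ, ∫⁻ x : Fin m → ℝ, ‖chainKernel 1 (m + 1) a (Fin.cons y x) b‖ₑ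
        ≤ ∫⁻ y : ℝ, ENNReal.ofReal
            (3 * C * (1 + |a - b|) ^ (-(θ / 3)) * (w (y - a) + w (y - b))) := by
          refine lintegral_mono fun y => ?_
          simp only [chainKernel_cons, enorm_mul]
          rw [lintegral_const_mul' _ _ (by simp)]
          refine (mul_le_mul_right (hle y b) _).trans ?_
          rw [← ofReal_norm, ← ENNReal.ofReal_mul (norm_nonneg _)]
          refine ENNReal.ofReal_le_ofReal ?_
          have h1 := norm_dirichlet_one_le (y - a)
          have h2 := rpow_mul_rpow_le hθ hθ1 (le_add_of_nonneg_right (abs_nonneg (y - a)))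
            (le_add_of_nonneg_right (abs_nonneg (y - b)))
            (le_add_of_nonneg_right (abs_nonneg (a - b))) (one_add_abs_add_le a b y)
          calc ‖dirichlet 1 (y - a)‖ * (C * (1 + |y - b|) ^ (-θ))
              ≤ 3 * (1 + |y - a|) ^ (-1 : ℝ) * (C * (1 + |y - b|) ^ (-θ)) := by gcongr
            _ = 3 * C * ((1 + |y - a|) ^ (-1 : ℝ) * (1 + |y - b|) ^ (-θ)) := by ring
            _ ≤ 3 * C * _ := mul_le_mul_of_nonneg_left h2 (by positivity)
            _ = _ := by simp only [hw, Real.norm_eq_abs]; ring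
      _ = ENNReal.ofReal (3 * C * (2 * ∫ y, w y) * (1 + |a - b|) ^ (-(θ / 3))) := by
          rw [← ofReal_integral_eq_lintegral_ofReal hwab
            (Eventually.of_forall fun y => by positivity), integral_const_mul,
            integral_add (hwi.comp_sub_right a) (hwi.comp_sub_right b),
            integral_sub_right_eq_self w a, integral_sub_right_eq_self w b]
          congr 1
          ring

theorem integrable_chainKernel (m : ℕ) (a b : ℝ) :
    Integrable fun x => chainKernel 1 m a x b := by
  obtain ⟨C, θ, -, -, -, hle⟩ := exists_lintegral_chainKernel_le m
  exact ⟨((continuous_chainKernel 1 m).comp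
    (f := fun x : Fin m → ℝ => (a, x, b)) (by fun_prop)).aestronglyMeasurable,
    (hle a b).trans_lt ENNReal.ofReal_lt_top⟩

/-- Each variable integrated out collapses two adjacent kernels into one, at the price of a factor
2π. -/
theorem integral_chainKernel (m : ℕ) (a b : ℝ) :
    ∫ x, chainKernel 1 m a x b = (2 * Real.pi) ^ m * dirichlet 1 (b - a) := by
  induction m generalizing a with
  | zero =>
    rw [volume_pi, Measure.pi_of_empty (x := 0), integral_dirac, chainKernel, pow_zero, one_mul]
  | succ m ih =>
    rw [integral_fin_succ (integrable_chainKernel (m + 1) a b)]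
    simp only [chainKernel_cons, integral_const_mul, ih]
    rw [pow_succ, mul_assoc, ← integral_dirichlet_mul_dirichlet a b, ← integral_const_mul]
    congr 1
    funext y
    ring

/-! ### Plane waves and the spectral representation -/

theorem memLp_exp_I_mul_mul (T y : ℝ) :
    MemLp (fun t : ℝ => Complex.exp (Complex.I * (y : ℂ) * (t : ℂ))) 2
      (volume.restrict (Icc (0 : ℝ) T)) :=
  MemLp.of_bound (by fun_prop : Continuous fun t : ℝ =>
    Complex.exp (Complex.I * (y : ℂ) * (t : ℂ))).aestronglyMeasurable 1
      (Eventually.of_forall fun t => (norm_exp_I_mul_mul y t).le)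

/-- The function `t ↦ e^{iyt}` as an element of `L²[0,T]`. -/
noncomputable def planeWave (T y : ℝ) : L2 T := (memLp_exp_I_mul_mul T y).toLp

theorem coeFn_planeWave (T y : ℝ) : planeWave T y =ᵐ[volume.restrict (Icc (0 : ℝ) T)]
    fun t => Complex.exp (Complex.I * (y : ℂ) * (t : ℂ)) :=
  (memLp_exp_I_mul_mul T y).coeFn_toLp

theorem inner_planeWave_right (T y : ℝ) (u : L2 T) :
    ⟪u, planeWave T y⟫_ℂ = ∫ t in Icc (0 : ℝ) T,
      Complex.exp (Complex.I * (y : ℂ) * (t : ℂ)) * (starRingEnd ℂ) (u t) := by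
  rw [L2.inner_def]
  refine integral_congr_ae ?_
  filter_upwards [coeFn_planeWave T y] with t ht
  rw [ht, RCLike.inner_apply]

theorem inner_planeWave_left (T y : ℝ) (v : L2 T) :
    ⟪planeWave T y, v⟫_ℂ = ∫ t in Icc (0 : ℝ) T,
      Complex.exp (Complex.I * ((-y : ℝ) : ℂ) * (t : ℂ)) * v t := by
  rw [L2.inner_def]
  refine integral_congr_ae ?_
  filter_upwards [coeFn_planeWave T y] with t ht
  rw [ht, RCLike.inner_apply, conj_exp_I_mul_mul, mul_comm]

theorem inner_planeWave_planeWave (T a b : ℝ) :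
    ⟪planeWave T a, planeWave T b⟫_ℂ = dirichlet T (b - a) := by
  rw [inner_planeWave_left, dirichlet]
  refine integral_congr_ae ?_
  filter_upwards [coeFn_planeWave T b] with t ht
  rw [ht, ← Complex.exp_add]
  congr 1
  push_cast
  ring

theorem norm_planeWave_sq_le {T : ℝ} (hT : 0 ≤ T) (y : ℝ) : ‖planeWave T y‖ ^ 2 ≤ T := by
  have h := inner_self_eq_norm_sq_to_K (𝕜 := ℂ) (planeWave T y)
  rw [inner_planeWave_planeWave] at h
  have h1 := norm_dirichlet_le hT (y - y)
  rw [h, norm_pow] at h1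
  simpa using h1

theorem continuous_inner_planeWave_left (T : ℝ) (v : L2 T) :
    Continuous fun y => ⟪planeWave T y, v⟫_ℂ := by
  simp only [inner_planeWave_left]
  refine continuous_of_dominated (bound := fun t => ‖v t‖) ?_ ?_ (integrable_L2 v).norm ?_
  · intro y
    exact (by fun_prop : Continuous fun t : ℝ =>
      Complex.exp (Complex.I * ((-y : ℝ) : ℂ) * (t : ℂ))).aestronglyMeasurable.mul
        (Lp.aestronglyMeasurable v)
  · intro y
    refine Eventually.of_forall fun t => ?_
    rw [norm_mul, norm_exp_I_mul_mul, one_mul]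
  · exact Eventually.of_forall fun t => by fun_prop

theorem continuous_inner_planeWave_right (T : ℝ) (u : L2 T) :
    Continuous fun y => ⟪u, planeWave T y⟫_ℂ := by
  have h := Complex.continuous_conj.comp (continuous_inner_planeWave_left T u)
  refine h.congr fun y => ?_
  simp [Function.comp]

/-- The spectral representation `⟪u, W_T(h) v⟫ = ∫ h(y) ⟪u, e_y⟫ ⟪e_y, v⟫ dy`. -/
theorem inner_toeplitzOp {T : ℝ} {h : ℝ → ℝ} (hh : Integrable h) (u v : L2 T) :
    ⟪u, toeplitzOp T h v⟫_ℂ = ∫ y : ℝ, h y * (⟪u, planeWave T y⟫_ℂ * ⟪planeWave T y, v⟫_ℂ) := by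
  set ρ := volume.restrict (Icc (0 : ℝ) T) with hρ
  set G : ℝ → ℝ × ℝ → ℂ := fun y z => h y *
    ((Complex.exp (Complex.I * (y : ℂ) * (z.1 : ℂ)) * (starRingEnd ℂ) (u z.1)) *
      (Complex.exp (Complex.I * ((-y : ℝ) : ℂ) * (z.2 : ℂ)) * v z.2)) with hG
  have hu : Integrable (fun t => (starRingEnd ℂ) (u t)) ρ :=
    (integrable_L2 u).congr' (Complex.continuous_conj.comp_aestronglyMeasurable
      (Lp.aestronglyMeasurable u)) (Eventually.of_forall fun t => by simp)
  -- Fubini applies because the exponentials have modulus 1 and u, v, being in L² of a finite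
  -- measure, are integrable.
  have hGi : Integrable (Function.uncurry G) (volume.prod (ρ.prod ρ)) := by
    have h1 : Integrable (fun w : ℝ × ℝ × ℝ =>
        (h w.1 : ℂ) * ((starRingEnd ℂ) (u w.2.1) * v w.2.2)) (volume.prod (ρ.prod ρ)) :=
      hh.ofReal.mul_prod (hu.mul_prod (integrable_L2 v))
    have hc : Continuous fun w : ℝ × ℝ × ℝ =>
        Complex.exp (Complex.I * (w.1 : ℂ) * (w.2.1 : ℂ)) *
        Complex.exp (Complex.I * ((-w.1 : ℝ) : ℂ) * (w.2.2 : ℂ)) := by fun_prop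
    refine (h1.bdd_mul (c := 1) hc.aestronglyMeasurable
      (Eventually.of_forall fun w => ?_)).congr (Eventually.of_forall fun w => ?_)
    · rw [norm_mul, norm_exp_I_mul_mul, norm_exp_I_mul_mul, one_mul]
    · simp only [Function.uncurry, hG]
      ring
  have e1 : ∀ y : ℝ, h y * (⟪u, planeWave T y⟫_ℂ * ⟪planeWave T y, v⟫_ℂ)
      = ∫ z, G y z ∂(ρ.prod ρ) := by
    intro y
    simp only [hG]
    rw [integral_const_mul, inner_planeWave_right, inner_planeWave_left]
    congr 1
    exact (integral_prod_mul (μ := ρ) (ν := ρ)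
      (fun t : ℝ => Complex.exp (Complex.I * (y : ℂ) * (t : ℂ)) * (starRingEnd ℂ) (u t))
      (fun t : ℝ => Complex.exp (Complex.I * ((-y : ℝ) : ℂ) * (t : ℂ)) * v t)).symm
  simp only [e1]
  have e2 : ∫ z, (∫ y, G y z) ∂(ρ.prod ρ) = ∫ t, ∫ s, (∫ y, G y (t, s)) ∂ρ ∂ρ :=
    integral_prod _ hGi.integral_prod_right
  rw [integral_integral_swap hGi, e2, L2.inner_def]
  refine integral_congr_ae ?_
  filter_upwards [toeplitzOp_apply T h v] with t ht
  rw [ht, RCLike.inner_apply, ← integral_mul_const]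
  refine integral_congr_ae (Eventually.of_forall fun s => ?_)
  simp only [fourierHat, hG]
  rw [← integral_mul_const, ← integral_mul_const]
  refine integral_congr_ae (Eventually.of_forall fun y => ?_)
  simp only
  rw [show Complex.I * (y : ℂ) * ((t - s : ℝ) : ℂ)
    = Complex.I * (y : ℂ) * (t : ℂ) + Complex.I * ((-y : ℝ) : ℂ) * (s : ℂ) by push_cast; ring,
    Complex.exp_add]
  ring

/-! ### Traces of products of Toeplitz operators -/

/-- Balls of radius 1/2 around orthonormal vectors are disjoint, and a separable space holds only
countably many disjoint nonempty open sets. Countability permits exchanging the basis sum with an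
integral. -/
theorem _root_.HilbertBasis.countable {ι H : Type*} [NormedAddCommGroup H] [InnerProductSpace ℂ H]
    [TopologicalSpace.SeparableSpace H] (b : HilbertBasis ι ℂ H) : Countable ι := by
  have hd : ∀ i j, i ≠ j → 1 ≤ dist (b i) (b j) := by
    intro i j hij
    have h := norm_sub_sq (𝕜 := ℂ) (b i) (b j)
    rw [b.orthonormal.1, b.orthonormal.1, b.orthonormal.2 hij] at h
    rw [dist_eq_norm]
    simp only [map_zero] at h
    nlinarith [norm_nonneg (b i - b j)]
  refine Set.countable_univ_iff.1 (Set.PairwiseDisjoint.countable_of_isOpen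
    (s := fun i => Metric.ball (b i) (1 / 2)) ?_ (fun i _ => Metric.isOpen_ball)
    (fun i _ => ⟨b i, Metric.mem_ball_self (by norm_num)⟩))
  intro i _ j _ hij
  exact Metric.ball_disjoint_ball (by have := hd i j hij; linarith)

/-- Cauchy–Schwarz followed by Bessel's inequality for each vector; this dominates the partial sums
in the trace computation. -/
theorem sum_norm_inner_mul_inner_le {ι H : Type*} [NormedAddCommGroup H] [InnerProductSpace ℂ H]
    [CompleteSpace H] (b : HilbertBasis ι ℂ H) (x y : H) (s : Finset ι) :
    ∑ i ∈ s, ‖⟪x, b i⟫_ℂ * ⟪b i, y⟫_ℂ‖ ≤ ‖x‖ * ‖y‖ := by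
  have hx := b.orthonormal.sum_inner_products_le (s := s) x
  have hy := b.orthonormal.sum_inner_products_le (s := s) y
  simp only [norm_mul]
  refine (Real.sum_mul_le_sqrt_mul_sqrt s _ _).trans ?_
  refine mul_le_mul ?_ ?_ (Real.sqrt_nonneg _) (norm_nonneg _)
  · rw [Real.sqrt_le_left (norm_nonneg _)]
    simpa only [norm_inner_symm x] using hx
  · rw [Real.sqrt_le_left (norm_nonneg _)]
    exact hy

/-- The trace of `W_T(h) B` is `∫ h(y) ⟪e_y, B e_y⟫ dy`. -/
theorem hasTrace_toeplitzOp_mul {T : ℝ} (hT : 0 ≤ T) {h : ℝ → ℝ} (hh : Integrable h)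
    (B : L2 T →L[ℂ] L2 T) :
    HasTrace (toeplitzOp T h * B) (∫ y : ℝ, h y * ⟪planeWave T y, B (planeWave T y)⟫_ℂ) := by
  intro ι b
  have : Fact ((2 : ℝ≥0∞) ≠ ⊤) := ⟨by simp⟩
  have : Countable ι := b.countable
  -- Moving B onto the plane wave leaves b i alone in both inner products, so Bessel and Parseval
  -- apply for each y. The form in `hFeq` makes continuity in y visible.
  set F : ι → ℝ → ℂ := fun i y =>
    h y * (⟪B.adjoint (planeWave T y), b i⟫_ℂ * ⟪b i, planeWave T y⟫_ℂ) with hF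
  have hFeq : ∀ i y, F i y = h y * (⟪planeWave T y, B (b i)⟫_ℂ * ⟪b i, planeWave T y⟫_ℂ) := by
    intro i y
    simp only [hF, ContinuousLinearMap.adjoint_inner_left]
  have hmeas : ∀ i, AEStronglyMeasurable (F i) := by
    intro i
    rw [show F i = _ from funext (hFeq i)]
    exact hh.ofReal.aestronglyMeasurable.mul
      ((continuous_inner_planeWave_left T _).mul
        (continuous_inner_planeWave_right T _)).aestronglyMeasurable
  have hbound : ∀ (s : Finset ι) (y : ℝ), ∑ i ∈ s, ‖F i y‖ ≤ |h y| * (‖B‖ * T) := by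
    intro s y
    simp only [hF, norm_mul (h y : ℂ), Complex.norm_real, Real.norm_eq_abs]
    rw [← Finset.mul_sum]
    refine mul_le_mul_of_nonneg_left ?_ (abs_nonneg _)
    refine (sum_norm_inner_mul_inner_le b _ _ s).trans ?_
    have h1 := B.adjoint.le_opNorm (planeWave T y)
    rw [LinearIsometryEquiv.norm_map] at h1
    calc ‖B.adjoint (planeWave T y)‖ * ‖planeWave T y‖
        ≤ ‖B‖ * ‖planeWave T y‖ * ‖planeWave T y‖ := by gcongr
      _ = ‖B‖ * ‖planeWave T y‖ ^ 2 := by ring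
      _ ≤ ‖B‖ * T := by gcongr; exact norm_planeWave_sq_le hT y
  have hint : ∀ i, Integrable (F i) := fun i =>
    (hh.abs.mul_const (‖B‖ * T)).mono' (hmeas i)
      (Eventually.of_forall fun y => by simpa using hbound {i} y)
  have hsum : Summable fun i => ∫ y, ‖F i y‖ := by
    refine summable_of_sum_le (c := ∫ y, |h y| * (‖B‖ * T))
      (fun i => integral_nonneg fun y => norm_nonneg _) fun s => ?_
    rw [← integral_finsetSum s fun i _ => (hint i).norm]
    exact integral_mono (integrable_finsetSum s fun i _ => (hint i).norm)
      (hh.abs.mul_const _) (hbound s)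
  have hmain := hasSum_integral_of_summable_integral_norm hint hsum
  have e1 : ∀ i, ∫ y, F i y = ⟪b i, (toeplitzOp T h * B) (b i)⟫_ℂ := by
    intro i
    rw [mul_apply_eq_comp, inner_toeplitzOp hh]
    congr 1
    funext y
    rw [hFeq, mul_comm ⟪b i, planeWave T y⟫_ℂ]
  have e2 : ∀ y, ∑' i, F i y = h y * ⟪planeWave T y, B (planeWave T y)⟫_ℂ := by
    intro y
    simp only [hF]
    rw [tsum_mul_left, b.tsum_inner_mul_inner, ContinuousLinearMap.adjoint_inner_left]
  simpa only [e1, e2] using hmain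

/-- The product `W_T(h₀) W_T(h₁) ⋯ W_T(h_{m-1})`. -/
noncomputable def toeplitzChain (T : ℝ) : ℕ → (ℕ → ℝ → ℝ) → (L2 T →L[ℂ] L2 T)
  | 0, _ => 1
  | m + 1, h => toeplitzOp T (h 0) * toeplitzChain T m (fun i => h (i + 1))

theorem integrable_prod_mul_chainKernel {T : ℝ} (hT : 0 ≤ T) (m : ℕ) {h : ℕ → ℝ → ℝ}
    (hh : ∀ i, Integrable (h i)) (a b : ℝ) :
    Integrable fun x : Fin m → ℝ => (∏ i : Fin m, (h i (x i) : ℂ)) * chainKernel T m a x b := by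
  have h1 : Integrable fun x : Fin m → ℝ => ∏ i : Fin m, (h i (x i) : ℂ) :=
    Integrable.fintype_prod (f := fun (i : Fin m) (t : ℝ) => (h i t : ℂ)) fun i => (hh i).ofReal
  refine h1.mul_bdd (c := T ^ (m + 1)) ((continuous_chainKernel T m).comp
    (f := fun x : Fin m → ℝ => (a, x, b)) (by fun_prop)).aestronglyMeasurable
    (Eventually.of_forall fun x => norm_chainKernel_le hT m a x b)

/-- The spectral representation is inserted for one operator at a time; each insertion produces the
next kernel ⟪e_a, e_y⟫ = D_T(y - a). -/
theorem inner_toeplitzChain {T : ℝ} (hT : 0 ≤ T) (m : ℕ) {h : ℕ → ℝ → ℝ}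
    (hh : ∀ i, Integrable (h i)) (a b : ℝ) :
    ⟪planeWave T a, toeplitzChain T m h (planeWave T b)⟫_ℂ
      = ∫ x : Fin m → ℝ, (∏ i : Fin m, (h i (x i) : ℂ)) * chainKernel T m a x b := by
  induction m generalizing h a with
  | zero =>
    rw [volume_pi, Measure.pi_of_empty (x := 0), integral_dirac]
    rw [Finset.univ_eq_empty, Finset.prod_empty, one_mul]
    exact inner_planeWave_planeWave T a b
  | succ m ih =>
    rw [toeplitzChain, mul_apply_eq_comp, inner_toeplitzOp (hh 0),
      integral_fin_succ (integrable_prod_mul_chainKernel hT (m + 1) hh a b)]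
    congr 1
    funext y
    rw [ih (h := fun i => h (i + 1)) (fun i => hh (i + 1)), inner_planeWave_planeWave,
      ← integral_const_mul, ← integral_const_mul]
    congr 1
    funext x
    rw [chainKernel_cons, Fin.prod_univ_succ]
    simp only [Fin.cons_zero, Fin.cons_succ, Fin.val_zero, Fin.val_succ]
    ring

end RieszBessel

/-! ### Hölder's inequality and continuity for finite products -/

section Holder

variable {X ι : Type*} [MeasurableSpace X] {μ : Measure X} {s : Finset ι} {p : ι → ℝ≥0∞}

theorem MeasureTheory.eLpNorm_finsetProd_le {f : ι → X → ℂ}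
    (hf : ∀ i ∈ s, AEStronglyMeasurable (f i) μ) :
    eLpNorm (∏ i ∈ s, f i) (∑ i ∈ s, (p i)⁻¹)⁻¹ μ ≤ ∏ i ∈ s, eLpNorm (f i) (p i) μ := by
  induction s using Finset.cons_induction with
  | empty =>
    simp only [Finset.prod_empty, Finset.sum_empty, ENNReal.inv_zero, eLpNorm_exponent_top]
    exact eLpNormEssSup_le_of_ae_enorm_bound (Eventually.of_forall fun x => by simp)
  | cons i s hi ih =>
    rw [Finset.prod_cons, Finset.prod_cons]
    have hs := fun j hj => hf j (Finset.mem_cons_of_mem hj)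
    refine (eLpNorm_smul_le_mul_eLpNorm (p := p i) (q := (∑ i ∈ s, (p i)⁻¹)⁻¹)
      (Finset.aestronglyMeasurable_prod s hs)
      (hf i (Finset.mem_cons_self ..)) (hpqr := ⟨by simp⟩)).trans ?_
    gcongr
    exact ih hs

theorem MeasureTheory.tendsto_eLpNorm_finsetProd_sub {κ : Type*} {l : Filter κ}
    {f : ι → X → ℂ} {v : κ → ι → X → ℂ} (hf : ∀ i ∈ s, MemLp (f i) (p i) μ)
    (hv : ∀ k, ∀ i ∈ s, MemLp (v k i) (p i) μ) (hp : ∑ i ∈ s, (p i)⁻¹ ≤ 1)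
    (hlim : ∀ i ∈ s, Tendsto (fun k => eLpNorm (v k i - f i) (p i) μ) l (𝓝 0)) :
    Tendsto (fun k => eLpNorm (∏ i ∈ s, v k i - ∏ i ∈ s, f i) (∑ i ∈ s, (p i)⁻¹)⁻¹ μ) l (𝓝 0) := by
  induction s using Finset.cons_induction with
  | empty => simpa using tendsto_const_nhds
  | cons i s hi ih =>
    have hms : ∀ j ∈ s, j ∈ Finset.cons i s hi := fun j hj => Finset.mem_cons_of_mem hj
    have hmi : i ∈ Finset.cons i s hi := Finset.mem_cons_self ..
    have hsum := Finset.sum_cons hi (f := fun i => (p i)⁻¹)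
    have ih' := ih (fun j hj => hf j (hms j hj)) (fun k j hj => hv k j (hms j hj))
      ((le_add_left le_rfl).trans (hsum ▸ hp)) (fun j hj => hlim j (hms j hj))
    set r := (∑ i ∈ s, (p i)⁻¹)⁻¹ with hr
    set t := (∑ i ∈ Finset.cons i s hi, (p i)⁻¹)⁻¹ with ht
    have ht1 : 1 ≤ t := ENNReal.one_le_inv.2 hp
    have : ENNReal.HolderTriple (p i) r t := ⟨by simp [hr, ht]⟩
    have hF : MemLp (∏ j ∈ s, f j) r μ := MemLp.prod fun j hj => hf j (hms j hj)
    have hV : ∀ k, MemLp (∏ j ∈ s, v k j) r μ := fun k =>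
      MemLp.prod fun j hj => hv k j (hms j hj)
    have hbound : ∀ k, eLpNorm (∏ i ∈ Finset.cons i s hi, v k i - ∏ i ∈ Finset.cons i s hi, f i) t μ
        ≤ eLpNorm (v k i - f i) (p i) μ * eLpNorm (∏ j ∈ s, v k j - ∏ j ∈ s, f j) r μ
          + eLpNorm (v k i - f i) (p i) μ * eLpNorm (∏ j ∈ s, f j) r μ
          + eLpNorm (f i) (p i) μ * eLpNorm (∏ j ∈ s, v k j - ∏ j ∈ s, f j) r μ := by
      intro k
      have h1 := ((hv k i hmi).sub (hf i hmi)).1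
      have h2 := ((hV k).sub hF).1
      -- Every term contains a difference tending to zero, and the other factors are differences or
      -- fixed functions, so no uniform bound on v k is required.
      have e : ∏ i ∈ Finset.cons i s hi, v k i - ∏ i ∈ Finset.cons i s hi, f i
          = (v k i - f i) • (∏ j ∈ s, v k j - ∏ j ∈ s, f j) + (v k i - f i) • (∏ j ∈ s, f j)
            + f i • (∏ j ∈ s, v k j - ∏ j ∈ s, f j) := by
        rw [Finset.prod_cons, Finset.prod_cons]
        simp only [smul_eq_mul]
        ring
      rw [e]
      refine (eLpNorm_add_le ((h1.smul h2).add (h1.smul hF.1)) ((hf i hmi).1.smul h2) ht1).trans ?_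
      refine add_le_add ((eLpNorm_add_le (h1.smul h2) (h1.smul hF.1) ht1).trans
        (add_le_add ?_ ?_)) ?_
      · exact eLpNorm_smul_le_mul_eLpNorm h2 h1
      · exact eLpNorm_smul_le_mul_eLpNorm hF.1 h1
      · exact eLpNorm_smul_le_mul_eLpNorm h2 (hf i hmi).1
    refine tendsto_of_tendsto_of_tendsto_of_le_of_le tendsto_const_nhds ?_
      (fun _ => zero_le) hbound
    have h1 := hlim i hmi
    have l1 := ENNReal.Tendsto.mul h1 (Or.inr ENNReal.zero_ne_top) ih' (Or.inr ENNReal.zero_ne_top)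
    have l2 := ENNReal.Tendsto.mul_const (b := eLpNorm (∏ j ∈ s, f j) r μ) h1
      (Or.inr hF.eLpNorm_ne_top)
    have l3 := ENNReal.Tendsto.const_mul (a := eLpNorm (f i) (p i) μ) ih'
      (Or.inr (hf i hmi).eLpNorm_ne_top)
    simpa using (l1.add l2).add l3

end Holder

/-! ### Integrals of products of translates -/

section Translation

theorem MeasureTheory.tendsto_eLpNorm_translate_sub {p : ℝ≥0∞} (hp : 1 ≤ p) (hp' : p ≠ ⊤)
    {u : ℝ → ℂ} (hu : MemLp u p) :
    Tendsto (fun z : ℝ => eLpNorm ((fun x => u (x + z)) - u) p) (𝓝 0) (𝓝 0) := by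
  have : Fact (1 ≤ p) := ⟨hp⟩
  -- Translations form a continuous family of measure-preserving maps, and composition with such a
  -- family is continuous in L^p for finite p.
  set G : C(ℝ, C(ℝ, ℝ)) :=
    (ContinuousMap.mk (fun w : ℝ × ℝ => w.2 + w.1) (by fun_prop)).curry with hG
  have hGm : ∀ z, MeasurePreserving (G z) (volume : Measure ℝ) volume := fun z =>
    measurePreserving_add_right volume z
  have h := Filter.Tendsto.compMeasurePreservingLp (f := fun _ : ℝ => hu.toLp u)
    (f₀ := hu.toLp u) tendsto_const_nhds (G.continuous.tendsto 0) hGm (hGm 0) hp'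
  simp only [Lp.toLp_compMeasurePreserving] at h
  rw [Lp.tendsto_Lp_iff_tendsto_eLpNorm''] at h
  refine h.congr fun z => ?_
  have h0 : (u ∘ (G 0)) = u := by funext x; simp [hG]
  rw [h0]
  rfl

variable {n : ℕ} {p : Fin n → ℝ≥0∞} {u : Fin n → ℝ → ℂ}

theorem MeasureTheory.MemLp.translate {p : ℝ≥0∞} {u : ℝ → ℂ} (hu : MemLp u p) (z : ℝ) :
    MemLp (fun x => u (x + z)) p :=
  hu.comp_measurePreserving (measurePreserving_add_right volume z)

theorem MeasureTheory.integrable_prod_translate (hu : ∀ i, MemLp (u i) (p i))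
    (hp : ∑ i, (p i)⁻¹ = 1) (z : Fin n → ℝ) : Integrable fun x => ∏ i, u i (x + z i) := by
  have h := MemLp.prod' (s := Finset.univ) (p := p) (f := fun i x => u i (x + z i))
    fun i _ => (hu i).translate (z i)
  rw [hp, inv_one] at h
  exact memLp_one_iff_integrable.1 h

theorem MeasureTheory.integral_norm_prod_translate_le (hu : ∀ i, MemLp (u i) (p i))
    (hp : ∑ i, (p i)⁻¹ = 1) (z : Fin n → ℝ) :
    ∫ x, ‖∏ i, u i (x + z i)‖ ≤ (∏ i, eLpNorm (u i) (p i)).toReal := by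
  have h := eLpNorm_finsetProd_le (μ := volume) (s := Finset.univ) (p := p)
    (f := fun i x => u i (x + z i)) fun i _ => ((hu i).translate (z i)).1
  rw [hp, inv_one, eLpNorm_one_eq_lintegral_enorm] at h
  rw [integral_norm_eq_lintegral_enorm (integrable_prod_translate hu hp z).1]
  refine ENNReal.toReal_mono (ENNReal.prod_ne_top fun i _ => (hu i).eLpNorm_ne_top) ?_
  have e : ∀ i, eLpNorm (fun x => u i (x + z i)) (p i) = eLpNorm (u i) (p i) := fun i =>
    eLpNorm_comp_measurePreserving (hu i).1 (measurePreserving_add_right volume (z i))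
  simpa only [e, Finset.prod_apply] using h

theorem MeasureTheory.tendsto_integral_prod_translate (hu : ∀ i, MemLp (u i) (p i))
    (hp1 : ∀ i, 1 ≤ p i) (hpt : ∀ i, p i ≠ ⊤) (hp : ∑ i, (p i)⁻¹ = 1) :
    Tendsto (fun z : Fin n → ℝ => ∫ x, ∏ i, u i (x + z i)) (𝓝 0) (𝓝 (∫ x, ∏ i, u i x)) := by
  have h := tendsto_eLpNorm_finsetProd_sub (μ := volume) (s := Finset.univ) (p := p) (f := u)
    (v := fun (z : Fin n → ℝ) i x => u i (x + z i)) (l := 𝓝 0) (fun i _ => hu i)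
    (fun z i _ => (hu i).translate (z i)) hp.le
    (fun i _ => (tendsto_eLpNorm_translate_sub (hp1 i) (hpt i) (hu i)).comp
      ((continuous_apply i).tendsto' 0 0 rfl))
  rw [hp, inv_one] at h
  have h0 : Integrable fun x => ∏ i, u i x := by
    simpa using integrable_prod_translate hu hp 0
  refine tendsto_integral_of_L1' _ h0.1
    (Eventually.of_forall fun z => integrable_prod_translate hu hp z) ?_
  refine h.congr fun z => ?_
  congr 1
  funext x
  simp [Finset.prod_apply]

end Translation

/-! ### The rescaled trace formula and its limit -/

namespace RieszBessel

/-- The exact formula for `tr W_T(h₀) ⋯ W_T(h_m)` after rescaling the frequencies by `1/T`. -/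
theorem hasTrace_toeplitzChain {T : ℝ} (hT : 0 < T) {m : ℕ} {h : ℕ → ℝ → ℝ}
    {p : Fin (m + 1) → ℝ≥0∞} (hm : ∀ i, Measurable (h i)) (hh : ∀ i, Integrable (h i))
    (hp : ∑ i, (p i)⁻¹ = 1) (hhp : ∀ i : Fin (m + 1), MemLp (fun x => (h i x : ℂ)) (p i)) :
    HasTrace (toeplitzChain T (m + 1) h) (T * ∫ y : Fin m → ℝ, chainKernel 1 m 0 y 0 *
      ∫ x : ℝ, ∏ i : Fin (m + 1),
        (h i (x + (Fin.cons 0 (T⁻¹ • y) : Fin (m + 1) → ℝ) i) : ℂ)) := by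
  rw [toeplitzChain]
  convert hasTrace_toeplitzOp_mul hT.le (hh 0) (toeplitzChain T m fun i => h (i + 1)) using 1
  set Q : ℝ → (Fin m → ℝ) → ℂ := fun x y => chainKernel 1 m 0 y 0 *
    ∏ i : Fin (m + 1), (h i (x + (Fin.cons 0 (T⁻¹ • y) : Fin (m + 1) → ℝ) i) : ℂ) with hQ
  have e1 : ∀ x : ℝ, h 0 x * ⟪planeWave T x,
      toeplitzChain T m (fun i => h (i + 1)) (planeWave T x)⟫_ℂ = T * ∫ y, Q x y := by
    intro x
    rw [inner_toeplitzChain hT.le m (h := fun i => h (i + 1)) fun i => hh (i + 1)]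
    set F : (Fin m → ℝ) → ℂ := fun z =>
      (∏ i : Fin m, (h (i + 1) (z i) : ℂ)) * chainKernel T m x z x with hF
    -- The substitution z = x + y/T has Jacobian T^{-m}, while the kernels scale by T^{m+1}; a
    -- single factor T survives.
    have h1 : ∫ y, F ((fun _ => x) + T⁻¹ • y) = (T : ℂ) ^ m * ∫ z, F z := by
      rw [Measure.integral_comp_inv_smul volume (fun z => F ((fun _ => x) + z)) T,
        integral_add_left_eq_self, Module.finrank_fin_fun, abs_of_pos (by positivity),
        Complex.real_smul]
      push_cast
      rfl
    have h2 : ∀ y, h 0 x * F ((fun _ => x) + T⁻¹ • y) = T ^ (m + 1) * Q x y := by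
      intro y
      have h3 := chainKernel_add_div hT m x 0 y 0
      simp only [zero_div, add_zero] at h3
      have h4 : ((fun _ => x) + T⁻¹ • y : Fin m → ℝ) = fun i => x + y i / T := by
        funext i
        simp [div_eq_inv_mul]
      simp only [hF, hQ]
      rw [h4, h3, Fin.prod_univ_succ]
      simp only [Fin.cons_zero, Fin.cons_succ, Fin.val_zero, Fin.val_succ, add_zero, Pi.smul_apply,
        smul_eq_mul, div_eq_inv_mul]
      ring
    have hT0 : (T : ℂ) ≠ 0 := by exact_mod_cast hT.ne'
    have h5 : h 0 x * ∫ y, F ((fun _ => x) + T⁻¹ • y) = T ^ (m + 1) * ∫ y, Q x y := by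
      rw [← integral_const_mul, ← integral_const_mul]
      exact integral_congr_ae (Eventually.of_forall h2)
    rw [h1, pow_succ] at h5
    refine mul_left_cancel₀ (pow_ne_zero m hT0) ?_
    linear_combination h5
  simp only [e1, integral_const_mul]
  congr 1
  have hQm : Measurable (Function.uncurry Q) := by
    refine Measurable.mul ?_ ?_
    · exact ((continuous_chainKernel 1 m).comp
        (f := fun w : ℝ × (Fin m → ℝ) => ((0 : ℝ), w.2, (0 : ℝ))) (by fun_prop)).measurable
    · refine Finset.measurable_prod _ fun i _ => Complex.measurable_ofReal.comp ((hm i).comp ?_)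
      refine measurable_fst.add ?_
      refine Fin.cases ?_ (fun j => ?_) i
      · simp
      · simp only [Fin.cons_succ]
        fun_prop
  -- The inner integral over x is bounded by Hölder uniformly in y, which leaves the integrable
  -- kernel in y.
  have hQi : Integrable (Function.uncurry Q) (volume.prod volume) := by
    rw [integrable_prod_iff' hQm.aestronglyMeasurable]
    refine ⟨Eventually.of_forall fun y => (integrable_prod_translate
      (u := fun i x => (h i x : ℂ)) hhp hp (Fin.cons 0 (T⁻¹ • y))).const_mul
      (chainKernel 1 m 0 y 0), ?_⟩
    refine ((integrable_chainKernel m 0 0).norm.mul_const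
      (∏ i : Fin (m + 1), eLpNorm (fun x => (h i x : ℂ)) (p i)).toReal).mono'
      hQm.norm.stronglyMeasurable.integral_prod_left'.aestronglyMeasurable (Eventually.of_forall fun y => ?_)
    rw [Real.norm_of_nonneg (integral_nonneg fun x => norm_nonneg _)]
    simp only [Function.uncurry, hQ, norm_mul (chainKernel 1 m 0 y 0)]
    rw [integral_const_mul]
    exact mul_le_mul_of_nonneg_left (integral_norm_prod_translate_le
      (u := fun i x => (h i x : ℂ)) hhp hp (Fin.cons 0 (T⁻¹ • y))) (norm_nonneg _)
  rw [integral_integral_swap hQi]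
  simp only [hQ, integral_const_mul]

/-- The asymptotics of `(1/T) tr W_T(h₀) ⋯ W_T(h_m)` as `T → ∞`. -/
theorem tendsto_trace_toeplitzChain {m : ℕ} {h : ℕ → ℝ → ℝ} {p : Fin (m + 1) → ℝ≥0∞}
    (hm : ∀ i, Measurable (h i)) (hh : ∀ i, Integrable (h i)) (hp1 : ∀ i, 1 ≤ p i)
    (hpt : ∀ i, p i ≠ ⊤) (hp : ∑ i, (p i)⁻¹ = 1)
    (hhp : ∀ i : Fin (m + 1), MemLp (fun x => (h i x : ℂ)) (p i)) :
    Tendsto (fun T : ℝ => 1 / (T : ℂ) * trace (toeplitzChain T (m + 1) h)) atTop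
      (𝓝 ((2 * Real.pi) ^ m * ∫ x : ℝ, ∏ i : Fin (m + 1), (h i x : ℂ))) := by
  set J : (Fin m → ℝ) → ℂ := fun z => ∫ x : ℝ, ∏ i : Fin (m + 1),
        (h i (x + (Fin.cons 0 z : Fin (m + 1) → ℝ) i) : ℂ) with hJ
  set C := (∏ i : Fin (m + 1), eLpNorm (fun x => (h i x : ℂ)) (p i)).toReal with hC
  have hJb : ∀ z, ‖J z‖ ≤ C := fun z => (norm_integral_le_integral_norm _).trans
    (integral_norm_prod_translate_le (u := fun i x => (h i x : ℂ)) hhp hp _)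
  have hJt : Tendsto J (𝓝 0) (𝓝 (∫ x : ℝ, ∏ i : Fin (m + 1), (h i x : ℂ))) := by
    refine (tendsto_integral_prod_translate (u := fun (i : Fin (m + 1)) x => (h i x : ℂ))
      hhp hp1 hpt hp).comp ?_
    have hc : Continuous fun z : Fin m → ℝ => (Fin.cons 0 z : Fin (m + 1) → ℝ) := by fun_prop
    refine hc.tendsto' 0 0 ?_
    funext i
    refine Fin.cases ?_ (fun j => ?_) i <;> simp
  have hJm : StronglyMeasurable J := by
    refine StronglyMeasurable.integral_prod_right (f := fun (z : Fin m → ℝ) (x : ℝ) =>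
      ∏ i : Fin (m + 1), (h i (x + (Fin.cons 0 z : Fin (m + 1) → ℝ) i) : ℂ)) ?_
    refine Measurable.stronglyMeasurable ?_
    refine Finset.measurable_prod _ fun i _ => Complex.measurable_ofReal.comp ((hm i).comp ?_)
    refine measurable_snd.add ?_
    refine Fin.cases ?_ (fun j => ?_) i
    · simp
    · simp only [Fin.cons_succ]
      fun_prop
  have hlim : Tendsto (fun T : ℝ => ∫ y : Fin m → ℝ, chainKernel 1 m 0 y 0 * J (T⁻¹ • y)) atTop
      (𝓝 (∫ y : Fin m → ℝ, chainKernel 1 m 0 y 0 *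
        ∫ x : ℝ, ∏ i : Fin (m + 1), (h i x : ℂ))) := by
    refine tendsto_integral_filter_of_dominated_convergence
      (fun y => ‖chainKernel 1 m 0 y 0‖ * C) ?_ ?_
      ((integrable_chainKernel m 0 0).norm.mul_const C) ?_
    · exact Eventually.of_forall fun T => (integrable_chainKernel m 0 0).1.mul
        (hJm.comp_measurable (measurable_const_smul T⁻¹)).aestronglyMeasurable
    · refine Eventually.of_forall fun T => Eventually.of_forall fun y => ?_
      rw [norm_mul]
      exact mul_le_mul_of_nonneg_left (hJb _) (norm_nonneg _)
    · refine Eventually.of_forall fun y => (hJt.comp ?_).const_mul _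
      simpa using (tendsto_inv_atTop_zero (𝕜 := ℝ)).smul_const y
  rw [integral_mul_const, integral_chainKernel, sub_zero] at hlim
  have hd : dirichlet 1 0 = 1 := by simp [dirichlet]
  rw [hd, mul_one] at hlim
  refine hlim.congr' ?_
  filter_upwards [eventually_gt_atTop 0] with T hT
  rw [(hasTrace_toeplitzChain hT hm hh hp hhp).trace_eq]
  have hT0 : (T : ℂ) ≠ 0 := by exact_mod_cast hT.ne'
  field_simp
  rfl

end RieszBessel

/-! ### Integrability of the symbols -/

/-- Split at |g| = 1: the set where |g| ≥ 1 has finite measure, so there L^q embeds in L^r; off it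
|g|^r ≤ |g|. -/
theorem MeasureTheory.Integrable.memLp_of_memLp {X : Type*} [MeasurableSpace X] {μ : Measure X}
    {g : X → ℝ} (h1 : Integrable g μ) {q r : ℝ≥0∞} (hq : MemLp g q μ) (hr1 : 1 ≤ r) (hrq : r ≤ q)
    (hrt : r ≠ ⊤) : MemLp g r μ := by
  wlog hg : StronglyMeasurable g generalizing g
  · have e := h1.1.ae_eq_mk
    exact (memLp_congr_ae e).2
      (this (h1.congr e) ((memLp_congr_ae e).1 hq) h1.1.stronglyMeasurable_mk)
  set S := {x | 1 ≤ ‖g x‖} with hS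
  have hSm : MeasurableSet S := hg.measurable.norm measurableSet_Ici
  have hSf : μ S < ⊤ := h1.measure_norm_ge_lt_top one_pos
  have : IsFiniteMeasure (μ.restrict S) := ⟨by simpa using hSf⟩
  have hA : MemLp (S.indicator g) r μ :=
    (memLp_indicator_iff_restrict hSm).2 (hq.restrict S |>.mono_exponent hrq)
  have hr0 : r ≠ 0 := (one_pos.trans_le hr1).ne'
  have hr1' : 1 ≤ r.toReal := by
    rw [← ENNReal.toReal_one]
    exact ENNReal.toReal_mono hrt hr1
  have hB : MemLp (Sᶜ.indicator g) r μ := by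
    have hm := (hg.indicator hSm.compl).aestronglyMeasurable (μ := μ)
    rw [← integrable_norm_rpow_iff hm hr0 hrt]
    refine h1.norm.mono' (hm.norm.aemeasurable.pow_const _).aestronglyMeasurable
      (Eventually.of_forall fun x => ?_)
    rw [Real.norm_of_nonneg (by positivity)]
    by_cases hx : x ∈ Sᶜ
    · rw [indicator_of_mem hx]
      have hx' : ‖g x‖ ≤ 1 := (not_le.1 (show ¬1 ≤ ‖g x‖ from hx)).le
      simpa using Real.rpow_le_rpow_of_exponent_ge' (norm_nonneg (g x)) hx' zero_le_one hr1'
    · rw [indicator_of_notMem hx, norm_zero, Real.zero_rpow (by linarith)]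
      exact norm_nonneg _
  rw [← indicator_self_add_compl S g]
  exact hA.add hB

namespace RieszBessel

theorem measurable_density (c α β : ℝ) : Measurable (density c α β) := by
  unfold density
  fun_prop

/-- On (0,1] the function is dominated by x^{-a}, on (1,∞) by x^{-(a+2b)}; reflection handles the
negative axis. -/
theorem integrable_abs_rpow_mul {a b : ℝ} (ha1 : a < 1) (hb : 0 ≤ b)
    (hab : 1 < a + 2 * b) : Integrable fun x : ℝ => |x| ^ (-a) * (1 + x ^ 2) ^ (-b) := by
  have h1 : IntegrableOn (fun x : ℝ => x ^ (-a)) (Ioc 0 1) :=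
    (intervalIntegrable_iff_integrableOn_Ioc_of_le zero_le_one).1
      (intervalIntegral.intervalIntegrable_rpow' (by linarith))
  have h2 : IntegrableOn (fun x : ℝ => x ^ (-(a + 2 * b))) (Ioi 1) :=
    integrableOn_Ioi_rpow_of_lt (by linarith) one_pos
  have hm : Measurable fun x : ℝ => |x| ^ (-a) * (1 + x ^ 2) ^ (-b) := by fun_prop
  have hpos : IntegrableOn (fun x : ℝ => |x| ^ (-a) * (1 + x ^ 2) ^ (-b)) (Ioi 0) := by
    rw [← Ioc_union_Ioi_eq_Ioi zero_le_one]
    refine IntegrableOn.union ?_ ?_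
    · refine h1.mono' hm.aestronglyMeasurable ?_
      filter_upwards [ae_restrict_mem measurableSet_Ioc] with x hx
      rw [Real.norm_of_nonneg (by positivity), abs_of_pos hx.1]
      refine mul_le_of_le_one_right (Real.rpow_nonneg hx.1.le _) ?_
      exact Real.rpow_le_one_of_one_le_of_nonpos (by nlinarith [sq_nonneg x]) (neg_nonpos.2 hb)
    · refine h2.mono' hm.aestronglyMeasurable ?_
      filter_upwards [ae_restrict_mem measurableSet_Ioi] with x hx
      have hx0 : 0 < x := one_pos.trans hx
      rw [Real.norm_of_nonneg (by positivity), abs_of_pos hx0, neg_add, Real.rpow_add hx0]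
      refine mul_le_mul_of_nonneg_left ?_ (Real.rpow_nonneg hx0.le _)
      calc (1 + x ^ 2) ^ (-b) ≤ (x ^ 2) ^ (-b) :=
            Real.rpow_le_rpow_of_nonpos (by positivity) (by linarith) (by linarith)
        _ = x ^ (-(2 * b)) := by
            rw [← Real.rpow_natCast, ← Real.rpow_mul hx0.le]
            congr 1
            push_cast
            ring
  have hneg : IntegrableOn (fun x : ℝ => |x| ^ (-a) * (1 + x ^ 2) ^ (-b)) (Iic 0) := by
    have hneg : MeasurableEmbedding fun x : ℝ => -x := (Homeomorph.neg ℝ).measurableEmbedding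
    rw [← Measure.map_neg_eq_self (volume : Measure ℝ)]
    refine hneg.integrableOn_map_iff.2 ?_
    simpa [Function.comp_def, integrableOn_Ici_iff_integrableOn_Ioi] using hpos
  rw [← integrableOn_univ, ← Iic_union_Ioi (a := (0 : ℝ))]
  exact hneg.union hpos

theorem memLp_density {c α β s : ℝ} (hc : 0 < c) (hβ : 0 < β) (hs : 1 ≤ s)
    (hαs : 2 * α * s < 1) (hαβ : 1 / 2 < α + β) :
    MemLp (density c α β) (ENNReal.ofReal s) := by
  have hs0 : 0 < s := by linarith
  rw [← integrable_norm_rpow_iff (measurable_density c α β).aestronglyMeasurable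
    (by simpa using hs0) ENNReal.ofReal_ne_top, ENNReal.toReal_ofReal hs0.le]
  have h := (integrable_abs_rpow_mul (a := 2 * α * s) (b := β * s) hαs (by positivity)
    (by nlinarith)).const_mul (c ^ s)
  refine h.congr (Eventually.of_forall fun x => ?_)
  have hx : 0 < 1 + x ^ 2 := by positivity
  simp only [density]
  rw [Real.norm_of_nonneg (by positivity), Real.mul_rpow (by positivity) (by positivity),
    Real.mul_rpow hc.le (by positivity), ← Real.rpow_mul (abs_nonneg x), ← Real.rpow_mul hx.le]
  ring_nf

/-- This allows g to be replaced by a Borel representative, as the trace formula asks for measurable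
symbols. -/
theorem toeplitzOp_congr {g h : ℝ → ℝ} (hgh : g =ᵐ[volume] h) (T : ℝ) :
    toeplitzOp T g = toeplitzOp T h := by
  have e : fourierHat g = fourierHat h := by
    funext t
    refine integral_congr_ae ?_
    filter_upwards [hgh] with x hx
    rw [hx]
  ext u
  filter_upwards [toeplitzOp_apply T g u, toeplitzOp_apply T h u] with t h1 h2
  rw [h1, h2, e]

/-! ### Alternating products and the choice of exponents -/

/-- The sequence `f, g, f, g, …`. -/
def alternate {A : Type*} (f g : A) (i : ℕ) : A := if Even i then f else g

theorem toeplitzProd_eq_toeplitzChain (ν : ℕ) (f g : ℝ → ℝ) (T : ℝ) :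
    toeplitzProd ν f g T = toeplitzChain T (2 * ν) (alternate f g) := by
  induction ν with
  | zero => rfl
  | succ k ih =>
    have e : (fun i => alternate f g (i + 1 + 1)) = alternate f g := by
      funext i
      simp [alternate, Nat.even_add_one]
    rw [Nat.mul_succ, toeplitzChain, toeplitzChain, e, ← ih, toeplitzProd, pow_succ', mul_assoc]
    simp [alternate, toeplitzProd]

theorem sum_range_alternate (a b : ℝ≥0∞) (k : ℕ) :
    ∑ i ∈ Finset.range (2 * k), (alternate a b i)⁻¹ = k * (a⁻¹ + b⁻¹) := by
  induction k with
  | zero => simp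
  | succ k ih =>
    rw [Nat.mul_succ, Finset.sum_range_succ, Finset.sum_range_succ, ih]
    simp only [alternate, even_two_mul, if_true, Nat.even_add_one, not_true_eq_false, if_false]
    push_cast
    ring

theorem prod_range_alternate (f g : ℝ → ℝ) (k : ℕ) (x : ℝ) :
    ∏ i ∈ Finset.range (2 * k), (alternate f g i x : ℂ) = (((f x * g x) ^ k : ℝ) : ℂ) := by
  induction k with
  | zero => simp
  | succ k ih =>
    rw [Nat.mul_succ, Finset.prod_range_succ, Finset.prod_range_succ, ih]
    simp only [alternate, even_two_mul, if_true, Nat.even_add_one, not_true_eq_false, if_false]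
    push_cast
    ring

/-- The trace approximation for a pair of integrable symbols `f ∈ L^p`, `g ∈ L^q` with conjugate
finite exponents. -/
theorem trace_approximation {ν : ℕ} (hν : 1 ≤ ν) {f g : ℝ → ℝ} {p q : ℝ≥0∞}
    (hf : Integrable f) (hg : Integrable g) (hfm : Measurable f) (hgm : Measurable g)
    (hfp : MemLp f p) (hgq : MemLp g q) (hp : 1 ≤ p) (hq : 1 ≤ q) (hpt : p ≠ ⊤) (hqt : q ≠ ⊤)
    (hpq : p⁻¹ + q⁻¹ = (ν : ℝ≥0∞)⁻¹) :
    Integrable (fun x => (f x * g x) ^ ν) ∧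
    (∀ T : ℝ, 0 < T → IsTraceClass (toeplitzProd ν f g T)) ∧
    Tendsto (fun T : ℝ => normalizedTrace ν f g T) atTop
      (𝓝 (((2 * Real.pi) ^ (2 * ν - 1) * ∫ x : ℝ, (f x * g x) ^ ν : ℝ) : ℂ)) := by
  obtain ⟨m, hm⟩ : ∃ m, 2 * ν = m + 1 := ⟨2 * ν - 1, by omega⟩
  have hall : ∀ {A : Type} (P : A → Prop) {a b : A}, P a → P b → ∀ i, P (alternate a b i) := by
    intro A P a b ha hb i
    unfold alternate
    split_ifs <;> assumption
  -- The 2ν factors form ν pairs, each contributing 1/p + 1/q = 1/ν.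
  have hsum : ∑ i : Fin (m + 1), (alternate p q i)⁻¹ = 1 := by
    rw [Fin.sum_univ_eq_sum_range (fun i => (alternate p q i)⁻¹), ← hm, sum_range_alternate, hpq]
    exact ENNReal.mul_inv_cancel (by simpa using (by omega : ν ≠ 0)) (by simp)
  have hprod : ∀ x, ∏ i : Fin (m + 1), (alternate f g i x : ℂ) = (((f x * g x) ^ ν : ℝ) : ℂ) := by
    intro x
    rw [Fin.prod_univ_eq_prod_range (fun i => (alternate f g i x : ℂ)), ← hm, prod_range_alternate]
  have hmem : ∀ i : Fin (m + 1),
      MemLp (fun x => (alternate f g i x : ℂ)) (alternate p q i) := by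
    intro i
    unfold alternate
    split_ifs
    · exact hfp.ofReal
    · exact hgq.ofReal
  have hmeas := hall Measurable hfm hgm
  have hint := hall (fun h : ℝ → ℝ => Integrable h) hf hg
  refine ⟨?_, fun T hT => ?_, ?_⟩
  · have h := integrable_prod_translate (u := fun (i : Fin (m + 1)) x => (alternate f g i x : ℂ))
      hmem hsum 0
    simp only [Pi.zero_apply, add_zero, hprod] at h
    exact h.re.congr (Eventually.of_forall fun x => Complex.ofReal_re _)
  · rw [toeplitzProd_eq_toeplitzChain, hm]
    exact ⟨_, hasTrace_toeplitzChain hT hmeas hint hsum hmem⟩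
  · have h := tendsto_trace_toeplitzChain hmeas hint (fun i => hall (fun r => 1 ≤ r) hp hq i)
      (fun i => hall (fun r => r ≠ ⊤) hpt hqt i) hsum hmem
    simp only [hprod, integral_complex_ofReal] at h
    have e : 2 * ν - 1 = m := by omega
    simp only [normalizedTrace, toeplitzProd_eq_toeplitzChain, hm, Nat.add_sub_cancel]
    push_cast
    exact h

theorem exists_conjugate_exponents {ν : ℕ} (hν : 1 ≤ ν) {α p : ℝ} {q : ℝ≥0∞} (hα : 0 < α)
    (hp : 1 ≤ p) (hpq : 1 / ENNReal.ofReal p + 1 / q ≤ 1 / (ν : ℝ≥0∞)) (hαp : α < 1 / (2 * p)) :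
    ∃ (s : ℝ) (r : ℝ≥0∞), 1 ≤ s ∧ 2 * α * s < 1 ∧ 1 ≤ r ∧ r ≤ q ∧ r ≠ ⊤ ∧
      (ENNReal.ofReal s)⁻¹ + r⁻¹ = (ν : ℝ≥0∞)⁻¹ := by
  simp only [one_div] at hpq
  have hp0 : 0 < p := by linarith
  rw [lt_div_iff₀ (by positivity)] at hαp
  -- The upper bound puts f in L^s. The strict lower bound gives 1/s < 1/p ≤ 1/ν, so the r defined
  -- by 1/r = 1/ν - 1/s is finite, and 1/r ≥ 1/q.
  obtain ⟨s, hps, hs⟩ : ∃ s, p < s ∧ s < 1 / (2 * α) :=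
    exists_between (by rw [lt_div_iff₀ (by positivity)]; linarith)
  rw [lt_div_iff₀ (by positivity)] at hs
  have hs0 : 0 < s := by linarith
  have hlt : (ENNReal.ofReal s)⁻¹ < (ENNReal.ofReal p)⁻¹ :=
    ENNReal.inv_lt_inv.2 ((ENNReal.ofReal_lt_ofReal_iff hs0).2 hps)
  have hpν : (ENNReal.ofReal p)⁻¹ ≤ (ν : ℝ≥0∞)⁻¹ := le_self_add.trans hpq
  have hsν := hlt.trans_le hpν
  have hν1 : (ν : ℝ≥0∞)⁻¹ ≤ 1 := ENNReal.inv_le_one.2 (by exact_mod_cast hν)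
  refine ⟨s, ((ν : ℝ≥0∞)⁻¹ - (ENNReal.ofReal s)⁻¹)⁻¹, by linarith, by linarith, ?_, ?_, ?_, ?_⟩
  · exact ENNReal.one_le_inv.2 (tsub_le_self.trans hν1)
  · rw [ENNReal.inv_le_iff_inv_le]
    exact ENNReal.le_sub_of_add_le_left hlt.ne_top ((add_le_add_left hlt.le _).trans hpq)
  · exact ENNReal.inv_ne_top.2 (tsub_pos_of_lt hsν).ne'
  · rw [inv_inv, add_tsub_cancel_of_le hsν.le]

end RieszBessel
theorem theorem4p2 (ν : ℕ) (hν : 1 ≤ ν) (c α β : ℝ) (hc : 0 < c) (hα : 0 < α) (hβ : 0 < β)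
    (g : ℝ → ℝ) (hg_int : Integrable g) (hg_even : ∀ x : ℝ, g (-x) = g x)
    (p : ℝ) (q : ℝ≥0∞) (hp : 1 ≤ p) (hq : 1 ≤ q)
    (hpq : 1 / ENNReal.ofReal p + 1 / q ≤ 1 / (ν : ℝ≥0∞))
    (hgq : MemLp g q) (hαp : α < 1 / (2 * p)) (hαβ : 1 / 2 < α + β) :
    Integrable (RieszBessel.density c α β) ∧
    Integrable (fun x : ℝ => (RieszBessel.density c α β x * g x) ^ ν) ∧
    (∀ T : ℝ, 0 < T →
      RieszBessel.IsTraceClass (RieszBessel.toeplitzProd ν (RieszBessel.density c α β) g T)) ∧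
    (fun T : ℝ => RieszBessel.traceError ν (RieszBessel.density c α β) g T)
      =o[atTop] (fun _ : ℝ => (1 : ℝ)) := by
  obtain ⟨s, r, hs, hαs, hr, hrq, hrt, hsr⟩ :=
    RieszBessel.exists_conjugate_exponents hν hα hp hpq hαp
  have hf1 : Integrable (RieszBessel.density c α β) := by
    -- Exponent 1 is admissible because 2α ≤ 2αs < 1.
    have h := RieszBessel.memLp_density (s := 1) hc hβ le_rfl (by nlinarith) hαβ
    rw [ENNReal.ofReal_one] at h
    exact memLp_one_iff_integrable.1 h
  have hgg := hg_int.1.ae_eq_mk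
  set g' := hg_int.1.mk g with hg'
  obtain ⟨h1, h2, h3⟩ := RieszBessel.trace_approximation hν hf1 (hg_int.congr hgg)
    (RieszBessel.measurable_density c α β) hg_int.1.stronglyMeasurable_mk.measurable
    (RieszBessel.memLp_density hc hβ hs hαs hαβ)
    ((memLp_congr_ae hgg).1 (hg_int.memLp_of_memLp hgq hr hrq hrt))
    (by simpa using hs) hr ENNReal.ofReal_ne_top hrt hsr
  have hprod : (fun x => (RieszBessel.density c α β x * g x) ^ ν)
      =ᵐ[volume] fun x => (RieszBessel.density c α β x * g' x) ^ ν := by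
    filter_upwards [hgg] with x hx
    rw [hx]
  have hop : ∀ T, RieszBessel.toeplitzProd ν (RieszBessel.density c α β) g T
      = RieszBessel.toeplitzProd ν (RieszBessel.density c α β) g' T := fun T => by
    rw [RieszBessel.toeplitzProd, RieszBessel.toeplitzProd, RieszBessel.toeplitzOp_congr hgg]
  refine ⟨hf1, h1.congr hprod.symm, fun T hT => hop T ▸ h2 T hT, ?_⟩
  rw [isLittleO_one_iff]
  simp only [RieszBessel.traceError, RieszBessel.normalizedTrace, hop, integral_congr_ae hprod]
  exact tendsto_iff_norm_sub_tendsto_zero.1 h3
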